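/- Let $m$ be Lebesgue measure on $(0,\infty)$ and let $S$ be the space of real measurable, a.e. finite functions on $(0,\infty)$, modulo a.e. equality. For $x\in S$ put $x^*(t)=\inf\{\tau\ge 0: m\{|x|>\tau\}\le t\}$, $t>0$; functions $x,y$ are equimeasurable if $m\{|x|>\tau\}=m\{|y|>\tau\}$ for all $\tau>0$. A rearrangement invariant (r.i.) space $X$ on $(0,\infty)$ is a nonzero Banach space $X\subset S$ such that ($x\in X$, $y\in S$, $|y|\le|x|$ a.e.) implies $y\in X$, $\|y\|_X\le\|x\|_X$, and ($y\in X$, $x\in S$, $x^*\le y^*$) implies $x\in X$, $\|x\|_X\le\|y\|_X$. Its fundamental function is $\phi_X(t)=\|\chi_A\|_X$, where $m(A)=t$. For a positive function $\psi$ on $(0,\infty)$ put $$M_\psi(t)=\sup_{s>0}\frac{\psi(ts)}{\psi(s)},\quad M^0_\psi(t)=\sup_{0<s\le\min(1,1/t)}\frac{\psi(ts)}{\psi(s)},\quad M^\infty_\psi(t)=\sup_{s\ge\max(1,1/t)}\frac{\psi(ts)}{\psi(s)},$$ $$\mu_\psi=-\lim_{n\to\infty}\tfrac1n\log_2M_\psi(2^{-n}),\quad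 \nu_\psi=\lim_{n\to\infty}\tfrac1n\log_2M_\psi(2^{n}),$$ $$\nu^0_\psi=\lim_{n\to\infty}\tfrac1n\log_2M^0_\psi(2^{n}),\quad \mu^\infty_\psi=-\lim_{n\to\infty}\tfrac1n\log_2M^\infty_\psi(2^{-n}).$$ For $1\le p\le\infty$, $\ell^p$ is said to be symmetrically block finitely represented in a sequence $\{z_i\}_{i\ge1}\subset X$ if for all $n\in\mathbb N$ and $\varepsilon>0$ there are integers $0=m_0<m_1<\dots<m_n$ and reals $\alpha_i$ such that the blocks $u_k=\sum_{i=m_{k-1}+1}^{m_k}\alpha_iz_i$, $k=1,\dots,n$, have pairwise disjoint supports, are equimeasurable, and satisfy $$(1+\varepsilon)^{-1}\|a\|_p\le\Big\|\sum_{k=1}^na_ku_k\Big\|_X\le(1+\varepsilon)\|a\|_p\qquad\text{for all }a=(a_k)_{k=1}^n\in\mathbb R^n.$$ Theorem. Let $X$ be a separable r.i. space on $(0,\infty)$ with fundamental function $\phi_X$, and let $\Delta_n^k=[2^{-n}(k-1),2^{-n}k)$, $n=0,1,\dots$, $k=1,2,\dots$. Let the countable family $\{\chi_{\Delta_n^k}\}_{n,k}$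 be arranged into a sequence by an arbitrary bijective enumeration of the pairs $(n,k)$. Then, with the convention $1/0=\infty$: (i) if $\mu^\infty_{\phi_X}\le\nu^0_{\phi_X}$, then $\ell^p$ is symmetrically block finitely represented in this sequence for every $p\in[1/\nu_{\phi_X},1/\mu_{\phi_X}]$; (ii) if $\mu^\infty_{\phi_X}>\nu^0_{\phi_X}$, then $\ell^p$ is symmetrically block finitely represented in this sequence for every $p\in[1/\nu_{\phi_X},1/\mu^\infty_{\phi_X}]\cup[1/\nu^0_{\phi_X},1/\mu_{\phi_X}]$. -/

import Mathlib

open MeasureTheory Filter Topology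

noncomputable section

namespace RISpaces

/-- Lebesgue measure on the half-line `(0, ∞)`. -/
abbrev mPos : Measure ℝ := volume.restrict (Set.Ioi 0)

/-- `S(0, ∞)`: the space of a.e. finite real measurable functions on `(0, ∞)`, modulo equality
almost everywhere. -/
abbrev S : Type := ℝ →ₘ[mPos] ℝ

/-- The characteristic function of a measurable set, as an element of `S`. -/
def charFn (A : Set ℝ) (hA : MeasurableSet A) : S :=
  AEEqFun.mk (A.indicator fun _ => (1 : ℝ))
    (stronglyMeasurable_const.indicator hA).aestronglyMeasurable

/-- The distribution function `τ ↦ m {s > 0 : |x(s)| > τ}`. -/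
def distrib (x : S) (τ : ℝ) : ENNReal := mPos {s | τ < |x s|}

/-- Equimeasurability: `m {|x| > τ} = m {|y| > τ}` for all `τ > 0`. -/
def Equimeasurable (x y : S) : Prop := ∀ τ : ℝ, 0 < τ → distrib x τ = distrib y τ

/-- The nonincreasing rearrangement
`x*(t) = inf {τ ≥ 0 : m {|x| > τ} ≤ t}`, with the usual convention `inf ∅ = ∞`. -/
def rearrangement (x : S) (t : ℝ) : ENNReal :=
  ⨅ (τ : ℝ) (_ : 0 ≤ τ ∧ distrib x τ ≤ ENNReal.ofReal t), ENNReal.ofReal τ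

/-- Disjointness of the supports (up to null sets). -/
def DisjointSupp (x y : S) : Prop := ∀ᵐ s ∂mPos, x s = 0 ∨ y s = 0

section Spaces

variable {E : Type*} [NormedAddCommGroup E] [NormedSpace ℝ E]

/-- `E`, viewed as a linear subspace of `S` through the injection `ι`, is a Banach function lattice
(ideal space): it is complete, and if `x ∈ E`, `y ∈ S`, `|y| ≤ |x|` a.e., then `y ∈ E` and
`‖y‖ ≤ ‖x‖`. -/
structure IsBanachFunctionLattice (ι : E →ₗ[ℝ] S) : Prop where
  complete : CompleteSpace E
  injective : Function.Injective ι
  ideal : ∀ (x : E) (y : S), |y| ≤ |ι x| → ∃ u : E, ι u = y ∧ ‖u‖ ≤ ‖x‖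

/-- A nonzero Banach function lattice on `(0, ∞)` is rearrangement invariant if `y ∈ E`, `x ∈ S`
and `x* ≤ y*` on `(0, ∞)` imply `x ∈ E` and `‖x‖ ≤ ‖y‖`. -/
structure IsRISpace (ι : E →ₗ[ℝ] S) : Prop extends IsBanachFunctionLattice ι where
  nontrivial : Nontrivial E
  symmetric : ∀ (y : E) (x : S), (∀ t : ℝ, 0 < t → rearrangement x t ≤ rearrangement (ι y) t) →
    ∃ u : E, ι u = x ∧ ‖u‖ ≤ ‖y‖

/-- The norm of the space `E ⊆ S` as an extended-valued function on `S`
(it is `∞` outside `E`). -/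
def extNorm (ι : E →ₗ[ℝ] S) (f : S) : ENNReal := ⨅ (u : E) (_ : ι u = f), ‖u‖ₑ

/-- The fundamental function `φ(t) = ‖χ_A‖`, `m(A) = t`; in an r.i. space the value does not depend
on the choice of `A`, and we take `A = (0, t)`. -/
def fundamentalFunction (ι : E →ₗ[ℝ] S) (t : ℝ) : ℝ :=
  (extNorm ι (charFn (Set.Ioo 0 t) measurableSet_Ioo)).toReal

/-- `ℓ^p` is symmetrically block finitely represented in the sequence `z` of elements of the space
`E ⊆ S`: for all `n` and `ε > 0` there are `n` successive blocks `u₁, …, uₙ` of `z` which are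
pairwise disjoint and equimeasurable and are `(1 + ε)`-equivalent to the unit vector basis of
`ℓ^p_n`. (The sequence `z` is indexed from `0`, so the block `u_k` runs over
`m_{k-1} ≤ i < m_k`.) -/
def SymmetricallyBlockFinitelyRepresented (ι : E →ₗ[ℝ] S) (p : ENNReal) (z : ℕ → S) : Prop :=
  ∀ (n : ℕ) (ε : ℝ), 0 < ε →
    ∃ (m : Fin (n + 1) → ℕ) (α : ℕ → ℝ) (u : Fin n → E),
      m 0 = 0 ∧ StrictMono m ∧
      (∀ k : Fin n, ι (u k) = ∑ i ∈ Finset.Ico (m k.castSucc) (m k.succ), α i • z i) ∧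
      (∀ j k : Fin n, j ≠ k → DisjointSupp (ι (u j)) (ι (u k))) ∧
      (∀ j k : Fin n, Equimeasurable (ι (u j)) (ι (u k))) ∧
      ∀ a : Fin n → ℝ,
        (1 + ε)⁻¹ * ‖WithLp.toLp p a‖ ≤ ‖∑ k, a k • u k‖ ∧
        ‖∑ k, a k • u k‖ ≤ (1 + ε) * ‖WithLp.toLp p a‖

end Spaces

/-- The characteristic function of the dyadic interval
`Δ_n^{k+1} = [2^{-n} k, 2^{-n} (k + 1))`, `n, k = 0, 1, 2, …`. -/
def dyadicChar (n k : ℕ) : S :=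
  charFn (Set.Ico ((k : ℝ) / 2 ^ n) (((k : ℝ) + 1) / 2 ^ n)) measurableSet_Ico

/-- The dilation function `M_ψ(t) = sup_{s > 0} ψ(ts) / ψ(s)`. -/
def dil (ψ : ℝ → ℝ) (t : ℝ) : ℝ := ⨆ s : Set.Ioi (0 : ℝ), ψ (t * s) / ψ s

/-- The dilation function `M_ψ^0(t) = sup_{0 < s ≤ min(1, 1/t)} ψ(ts) / ψ(s)`. -/
def dilZero (ψ : ℝ → ℝ) (t : ℝ) : ℝ := ⨆ s : Set.Ioc (0 : ℝ) (min 1 (1 / t)), ψ (t * s) / ψ s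

/-- The dilation function `M_ψ^∞(t) = sup_{s ≥ max(1, 1/t)} ψ(ts) / ψ(s)`. -/
def dilInfty (ψ : ℝ → ℝ) (t : ℝ) : ℝ := ⨆ s : Set.Ici (max (1 : ℝ) (1 / t)), ψ (t * s) / ψ s

/-- `- lim_{n → ∞} (1/n) log₂ M(2^{-n})`. -/
def lowerIndex (M : ℝ → ℝ) : ℝ :=
  -limUnder atTop fun n : ℕ => (1 / (n : ℝ)) * Real.logb 2 (M ((2 : ℝ) ^ (-(n : ℤ))))

/-- `lim_{n → ∞} (1/n) log₂ M(2^n)`. -/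
def upperIndex (M : ℝ → ℝ) : ℝ :=
  limUnder atTop fun n : ℕ => (1 / (n : ℝ)) * Real.logb 2 (M ((2 : ℝ) ^ n))

/-- The dilation index `μ_ψ`. -/
def muIndex (ψ : ℝ → ℝ) : ℝ := lowerIndex (dil ψ)

/-- The dilation index `ν_ψ`. -/
def nuIndex (ψ : ℝ → ℝ) : ℝ := upperIndex (dil ψ)

/-- The dilation index `ν_ψ^0`. -/
def nuZeroIndex (ψ : ℝ → ℝ) : ℝ := upperIndex (dilZero ψ)

/-- The dilation index `μ_ψ^∞`. -/
def muInftyIndex (ψ : ℝ → ℝ) : ℝ := lowerIndex (dilInfty ψ)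

/-- The reciprocal `1/r ∈ [0, ∞]` of a number `r ≥ 0`, with `1/0 = ∞`. -/
def recip (r : ℝ) : ENNReal := (ENNReal.ofReal r)⁻¹

end RISpaces

end

noncomputable section

namespace RISpaces

/-! Put `θ = 1/p` and suppose first that `F t = t ^ (-θ)` belonged to the space. A dilation acts by
`F (t / N) = N ^ θ * F t`, and if `∑ N k = 1`, disjoint copies of the functions `F (· / N k)` are
together equimeasurable with `F`, because dilation by `N` multiplies the distribution function by
`N`. Taking `N k = |c k| ^ p`, disjoint translates of `F` with coefficients `c k` would have norm
`‖c‖_p * ‖F‖`: they would span `ℓ^p` isometrically.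

Such a power need not lie in the space, so it is damped away from a point `c` and cut off at `a` and
`b`: `F t` is the integral over `[max a t, b]` of `min ((s/c)^e, (c/s)^e) * s^(-θ-1)`. The damping
costs a factor `N ^ (±e)`, close to `1` for `N` bounded below and `e` small. The cut-offs produce
errors that are multiples of the characteristic functions of `(0, a)` and `(0, b)`. These are
negligible against `‖F‖` once the damped `φ(t) t^(-θ)` is much smaller at `a` and `b` than at `c`,
which is `DecaysBothSides`. This is carried by `IsRISpace.exists_almostHomogeneous`,
`IsRISpace.nrm_copies_dilate` and `IsRISpace.exists_copiesLikeLp`.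

Replacing `F` by a dyadic step function changes norms little. Such a function can be rewritten with
arbitrarily short dyadic intervals, all of which come late in a given enumeration, so its integer
translates become successive blocks (`exists_block`, `exists_successive_blocks`).

It remains to link `DecaysBothSides` with the indices. If it fails, there are `e` and `C` such that
every point `c` satisfies `DecaysFromLeft` or `GrowsToRight`. Points of the first kind cannot lie
far to the right of points of the second (`TameGrowth.exists_ratio_bound`). Hence one point of the
first kind makes all points near `0` of that kind and gives `ν⁰ ≤ θ - e`; one point of the second
kind gives `μ^∞ ≥ θ + e`. If only one kind occurs, then `ν ≤ θ - e` or `μ ≥ θ + e`. In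
`TameGrowth.decaysBothSides` this contradicts each of the assumed ranges of `θ`. -/

/-! ### Distribution functions, and bounded functions of bounded support. -/

/-- The distribution function of a function on the half-line. -/
def dst (f : ℝ → ℝ) (τ : ℝ) : ENNReal := mPos {s | τ < |f s|}

lemma dst_congr {f g : ℝ → ℝ} (h : f =ᵐ[mPos] g) (τ : ℝ) : dst f τ = dst g τ := by
  apply measure_congr
  filter_upwards [h] with s hs
  have : (τ < |f s|) = (τ < |g s|) := by rw [hs]
  exact this

lemma dst_mono {f g : ℝ → ℝ} (h : ∀ᵐ s ∂mPos, |f s| ≤ |g s|) (τ : ℝ) : dst f τ ≤ dst g τ := by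
  apply measure_mono_ae
  filter_upwards [h] with s hs
  intro h1
  exact lt_of_lt_of_le h1 hs

lemma distrib_eq_dst {x : S} {f : ℝ → ℝ} (h : x =ᵐ[mPos] f) (τ : ℝ) : distrib x τ = dst f τ :=
  dst_congr h τ

lemma dst_eq_volume {f : ℝ → ℝ} (hf : ∀ t < 0, f t = 0) {τ : ℝ} (hτ : 0 ≤ τ) :
    dst f τ = volume {s | τ < |f s|} := by
  have hs : {s | τ < |f s|} ⊆ Set.Ici 0 := by
    intro s hs
    by_contra hc
    have h0 := hf s (not_le.mp hc)
    simp only [Set.mem_ofPred_eq, h0, abs_zero] at hs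
    linarith
  unfold dst mPos
  rw [Measure.restrict_congr_set Ioi_ae_eq_Ici, Measure.restrict_eq_self _ hs]

lemma rearrangement_le {x y : S} (h : ∀ τ, 0 ≤ τ → distrib x τ ≤ distrib y τ) (t : ℝ) :
    rearrangement x t ≤ rearrangement y t := by
  unfold rearrangement
  refine le_iInf fun τ => le_iInf fun hτ => ?_
  exact iInf_le_of_le τ (iInf_le_of_le ⟨hτ.1, (h τ hτ.1).trans hτ.2⟩ le_rfl)

/-- Bounded measurable functions with bounded support in `[0, ∞)`. -/
structure BddSupp (f : ℝ → ℝ) : Prop where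
  meas : Measurable f
  neg : ∀ t < 0, f t = 0
  bdd : ∃ C, ∀ t, |f t| ≤ C
  supp : ∃ B, ∀ t, B ≤ t → f t = 0

/-- The indicator function of `(0, t)`. -/
def chi (t : ℝ) : ℝ → ℝ := (Set.Ioo 0 t).indicator fun _ => 1

lemma chi_of_mem {t s : ℝ} (h0 : 0 < s) (h : s < t) : chi t s = 1 := by
  simp [chi, h0, h]

lemma chi_nonneg (t s : ℝ) : 0 ≤ chi t s := Set.indicator_nonneg (by simp) _

lemma chi_le_one (t s : ℝ) : chi t s ≤ 1 := Set.indicator_le_self' (by simp) _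

namespace BddSupp

lemma zero : BddSupp (fun _ => 0) :=
  ⟨measurable_const, by simp, ⟨0, by simp⟩, ⟨0, by simp⟩⟩

lemma add {f g : ℝ → ℝ} (hf : BddSupp f) (hg : BddSupp g) : BddSupp (fun t => f t + g t) := by
  obtain ⟨C, hC⟩ := hf.bdd
  obtain ⟨D, hD⟩ := hg.bdd
  obtain ⟨A, hA⟩ := hf.supp
  obtain ⟨B, hB⟩ := hg.supp
  refine ⟨hf.meas.add hg.meas, fun t ht => by simp [hf.neg t ht, hg.neg t ht],
    ⟨C + D, fun t => (abs_add_le _ _).trans (add_le_add (hC t) (hD t))⟩,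
    ⟨max A B, fun t ht => ?_⟩⟩
  rw [hA t ((le_max_left _ _).trans ht), hB t ((le_max_right _ _).trans ht), add_zero]

lemma const_mul {f : ℝ → ℝ} (hf : BddSupp f) (c : ℝ) : BddSupp (fun t => c * f t) := by
  obtain ⟨C, hC⟩ := hf.bdd
  obtain ⟨A, hA⟩ := hf.supp
  refine ⟨hf.meas.const_mul c, fun t ht => by simp [hf.neg t ht],
    ⟨|c| * C, fun t => ?_⟩, ⟨A, fun t ht => by simp [hA t ht]⟩⟩
  rw [abs_mul]
  exact mul_le_mul_of_nonneg_left (hC t) (abs_nonneg _)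

lemma sum {κ : Type*} (s : Finset κ) {f : κ → ℝ → ℝ} (hf : ∀ k ∈ s, BddSupp (f k)) :
    BddSupp (fun t => ∑ k ∈ s, f k t) := by
  classical
  induction s using Finset.induction_on with
  | empty => simpa using zero
  | insert a s ha ih =>
    simp only [Finset.sum_insert ha]
    exact (hf a (Finset.mem_insert_self _ _)).add
      (ih fun k hk => hf k (Finset.mem_insert_of_mem hk))

lemma chi (t : ℝ) : BddSupp (chi t) := by
  refine ⟨measurable_const.indicator measurableSet_Ioo, fun s hs => ?_, ⟨1, fun s => ?_⟩,
    ⟨t, fun s hs => ?_⟩⟩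
  · simp [RISpaces.chi, hs.le]
  · rw [abs_of_nonneg (chi_nonneg _ _)]; exact chi_le_one _ _
  · simp only [RISpaces.chi, Set.indicator_apply_eq_zero, Set.mem_Ioo]
    intro h; linarith

lemma shift {f : ℝ → ℝ} (hf : BddSupp f) {d : ℝ} (hd : 0 ≤ d) : BddSupp (fun t => f (t - d)) := by
  obtain ⟨C, hC⟩ := hf.bdd
  obtain ⟨A, hA⟩ := hf.supp
  exact ⟨hf.meas.comp (measurable_id.sub_const d), fun t ht => hf.neg _ (by linarith),
    ⟨C, fun t => hC _⟩, ⟨A + d, fun t ht => hA _ (by linarith)⟩⟩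

lemma dilate {f : ℝ → ℝ} (hf : BddSupp f) (h0 : f 0 = 0) {N : ℝ} (hN : 0 ≤ N) :
    BddSupp (fun t => f (t / N)) := by
  obtain ⟨C, hC⟩ := hf.bdd
  obtain ⟨A, hA⟩ := hf.supp
  rcases hN.eq_or_lt with rfl | hN
  · simpa [h0] using zero
  exact ⟨hf.meas.comp (measurable_id.div_const N),
    fun t ht => hf.neg _ (div_neg_of_neg_of_pos ht hN),
    ⟨C, fun t => hC _⟩, ⟨A * N, fun t ht => hA _ ((le_div_iff₀ hN).2 ht)⟩⟩

end BddSupp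

lemma dst_chi_of_lt {t τ : ℝ} (h0 : 0 ≤ τ) (h : τ < 1) :
    dst (chi t) τ = ENNReal.ofReal t := by
  rw [dst_eq_volume (BddSupp.chi t).neg h0]
  have : {s | τ < |chi t s|} = Set.Ioo 0 t := by
    ext s
    by_cases hs : s ∈ Set.Ioo 0 t
    · simp only [Set.mem_ofPred_eq, chi, Set.indicator_of_mem hs, hs, iff_true]; simpa using h
    · simp only [Set.mem_ofPred_eq, chi, Set.indicator_of_notMem hs, hs, iff_false]; simpa using h0
  rw [this]; simp

lemma dst_chi_of_le {t τ : ℝ} (h : 1 ≤ τ) : dst (chi t) τ = 0 := by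
  have : {s | τ < |chi t s|} = ∅ := by
    ext s
    simp only [Set.mem_ofPred_eq, Set.mem_empty_iff_false, iff_false, not_lt]
    rw [abs_of_nonneg (chi_nonneg _ _)]
    exact (chi_le_one _ _).trans h
  simp [dst, this]

lemma dst_shift {f : ℝ → ℝ} (hf : ∀ t < 0, f t = 0) {d τ : ℝ} (hd : 0 ≤ d) (hτ : 0 ≤ τ) :
    dst (fun t => f (t - d)) τ = dst f τ := by
  rw [dst_eq_volume hf hτ, dst_eq_volume (fun t ht => hf _ (by linarith)) hτ]
  have h := measure_preimage_add_right volume (-d) {s | τ < |f s|}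
  simp only [sub_eq_add_neg]
  exact h

lemma dst_dilate {f : ℝ → ℝ} (hf : ∀ t ≤ 0, f t = 0) {N τ : ℝ} (hN : 0 ≤ N) (hτ : 0 ≤ τ) :
    dst (fun t => f (t / N)) τ = ENNReal.ofReal N * dst f τ := by
  -- The value `N = 0` is admitted because coefficients may vanish later: `t / 0 = 0`, so the
  -- dilated function is the constant `f 0 = 0`.
  rcases hN.eq_or_lt with rfl | hN
  · have : ¬ τ < 0 := hτ.not_gt
    simp [dst, hf 0 le_rfl, this]
  rw [dst_eq_volume (fun t ht => hf t ht.le) hτ, dst_eq_volume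
    (fun t ht => hf _ (div_nonpos_of_nonpos_of_nonneg ht.le hN.le)) hτ]
  have := Real.volume_preimage_mul_right (inv_ne_zero hN.ne') {s | τ < |f s|}
  simpa [div_eq_mul_inv, abs_of_pos hN] using this

/-! ### The norm of the space as a rearrangement invariant functional on functions. -/

section

variable {E : Type*} [NormedAddCommGroup E] [NormedSpace ℝ E] {ι : E →ₗ[ℝ] S}

lemma IsRISpace.exists_of_dst (hι : IsRISpace ι) {u : E} {f g : ℝ → ℝ} (hf : Measurable f)
    (hg : ι u =ᵐ[mPos] g) (h : ∀ τ, 0 ≤ τ → dst f τ ≤ dst g τ) :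
    ∃ v : E, ι v =ᵐ[mPos] f ∧ ‖v‖ ≤ ‖u‖ := by
  obtain ⟨v, hv, hn⟩ := hι.symmetric u (AEEqFun.mk f hf.aestronglyMeasurable)
    (fun t _ => rearrangement_le (fun τ hτ => by
      rw [distrib_eq_dst (AEEqFun.coeFn_mk f _), distrib_eq_dst hg]; exact h τ hτ) t)
  exact ⟨v, hv ▸ AEEqFun.coeFn_mk f _, hn⟩

lemma repr_add {u v : E} {f g : ℝ → ℝ} (hf : ι u =ᵐ[mPos] f) (hg : ι v =ᵐ[mPos] g) :
    ι (u + v) =ᵐ[mPos] fun t => f t + g t := by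
  rw [map_add]
  filter_upwards [AEEqFun.coeFn_add (ι u) (ι v), hf, hg] with t h1 h2 h3
  rw [h1, Pi.add_apply, h2, h3]

lemma repr_smul {u : E} {f : ℝ → ℝ} (hf : ι u =ᵐ[mPos] f) (c : ℝ) :
    ι (c • u) =ᵐ[mPos] fun t => c * f t := by
  rw [map_smul]
  filter_upwards [AEEqFun.coeFn_smul c (ι u), hf] with t h1 h2
  rw [h1, Pi.smul_apply, h2, smul_eq_mul]

lemma repr_zero (ι : E →ₗ[ℝ] S) : ι 0 =ᵐ[mPos] fun _ => (0 : ℝ) := by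
  rw [map_zero]; exact AEEqFun.coeFn_zero

lemma repr_sum {κ : Type*} (s : Finset κ) {u : κ → E} {f : κ → ℝ → ℝ}
    (h : ∀ k ∈ s, ι (u k) =ᵐ[mPos] f k) : ι (∑ k ∈ s, u k) =ᵐ[mPos] fun t => ∑ k ∈ s, f k t := by
  classical
  induction s using Finset.induction_on with
  | empty => simpa using repr_zero ι
  | insert a s ha ih =>
    simp only [Finset.sum_insert ha]
    exact repr_add (h a (Finset.mem_insert_self _ _))
      (ih fun k hk => h k (Finset.mem_insert_of_mem hk))

/-- A nonzero element exceeds some `1 / (n + 1)` in absolute value on a set of positive measure, so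
its multiple by `n + 1` dominates some `chi t` in distribution. -/
lemma IsRISpace.exists_chi_pos (hι : IsRISpace ι) :
    ∃ t, 0 < t ∧ ∃ u : E, ι u =ᵐ[mPos] chi t := by
  obtain ⟨x, hx⟩ := @exists_ne E hι.nontrivial 0
  have h1 : ¬ (ι x =ᵐ[mPos] fun _ => (0 : ℝ)) := by
    intro h
    apply hx
    apply hι.injective
    apply AEEqFun.ext
    exact h.trans (repr_zero ι).symm
  have h2 : ∃ n : ℕ, dst (ι x) (1 / ((n : ℝ) + 1)) ≠ 0 := by
    by_contra! hc
    apply h1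
    have : ∀ᵐ s ∂mPos, ∀ n : ℕ, ¬ (1 / ((n : ℝ) + 1) < |ι x s|) := by
      rw [ae_all_iff]
      intro n
      rw [ae_iff]
      simp only [not_not]
      exact hc n
    filter_upwards [this] with s hs
    by_contra hne
    obtain ⟨n, hn⟩ := exists_nat_one_div_lt (abs_pos.mpr hne)
    exact hs n hn
  obtain ⟨n, hn⟩ := h2
  obtain ⟨t, ht0, ht⟩ : ∃ t : ℝ, 0 < t ∧
      ENNReal.ofReal t ≤ dst (ι x) (1 / ((n : ℝ) + 1)) := by
    obtain ⟨r, hr0, hr⟩ := ENNReal.lt_iff_exists_nnreal_btwn.1 (pos_iff_ne_zero.2 hn)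
    refine ⟨r, by exact_mod_cast hr0, ?_⟩
    simpa using hr.le
  refine ⟨t, ht0, ?_⟩
  have hr := repr_smul (Filter.EventuallyEq.refl _ (ι x : ℝ → ℝ)) ((n : ℝ) + 1) (ι := ι)
  obtain ⟨v, hv, -⟩ := hι.exists_of_dst (BddSupp.chi t).meas hr (fun τ hτ => by
    rcases lt_or_ge τ 1 with h | h
    · rw [dst_chi_of_lt hτ h]
      refine ht.trans (measure_mono fun s hs => ?_)
      simp only [Set.mem_ofPred_eq] at hs ⊢
      have hn0 : (0 : ℝ) < n + 1 := by positivity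
      rw [abs_mul, abs_of_pos hn0]
      rw [div_lt_iff₀ hn0] at hs
      linarith
    · rw [dst_chi_of_le h]; exact zero_le)
  exact ⟨v, hv⟩

lemma chi_two_mul_ae {t : ℝ} (ht : 0 < t) :
    ∀ᵐ s ∂mPos, chi (2 * t) s = chi t s + chi t (s - t) := by
  have h1 : ∀ᵐ s ∂mPos, s ≠ t := by
    exact compl_mem_ae_iff.2 (measure_singleton t)
  filter_upwards [h1] with s hs
  by_cases h0 : 0 < s
  · rcases lt_or_gt_of_ne hs with h | h
    · simp [chi, h0, h, h.le, show s < 2 * t by linarith]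
    · by_cases h2 : s < 2 * t
      · simp [chi, h0, h, h.le, h2, show s - t < t by linarith]
      · simp [chi, h0, h, h.le, h2, show ¬ (s - t < t) by linarith]
  · simp [chi, h0, show ¬ t < s by linarith]

lemma dst_chi_mono {s t : ℝ} (h : s ≤ t) (τ : ℝ) : dst (chi s) τ ≤ dst (chi t) τ := by
  refine dst_mono (Eventually.of_forall fun x => ?_) τ
  rw [abs_of_nonneg (chi_nonneg _ _), abs_of_nonneg (chi_nonneg _ _)]
  exact Set.indicator_le_indicator_of_subset (Set.Ioo_subset_Ioo_right h) (fun _ => zero_le_one) x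

/-- Adding a translate doubles the length of an interval already available; every `chi t` is
dominated by one obtained after enough doublings. -/
lemma IsRISpace.exists_chi (hι : IsRISpace ι) (t : ℝ) : ∃ u : E, ι u =ᵐ[mPos] chi t := by
  obtain ⟨t₀, ht₀, u₀, hu₀⟩ := hι.exists_chi_pos
  have key : ∀ n : ℕ, ∃ u : E, ι u =ᵐ[mPos] chi (2 ^ n * t₀) := by
    intro n
    induction n with
    | zero => exact ⟨u₀, by simpa using hu₀⟩
    | succ n ih =>
      obtain ⟨u, hu⟩ := ih
      have hp : 0 < 2 ^ n * t₀ := by positivity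
      obtain ⟨v, hv, -⟩ := hι.exists_of_dst ((BddSupp.chi (2 ^ n * t₀)).shift hp.le).meas hu
        (fun τ hτ => (dst_shift (BddSupp.chi _).neg hp.le hτ).le)
      refine ⟨u + v, ?_⟩
      filter_upwards [repr_add hu hv, chi_two_mul_ae hp] with s h1 h2
      rw [h1, pow_succ', mul_assoc, h2]
  obtain ⟨n, hn⟩ := pow_unbounded_of_one_lt (t / t₀) one_lt_two
  obtain ⟨u, hu⟩ := key n
  obtain ⟨v, hv, -⟩ := hι.exists_of_dst (BddSupp.chi t).meas hu
    (fun τ _ => dst_chi_mono ((div_lt_iff₀ ht₀).1 hn).le τ)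
  exact ⟨v, hv⟩

lemma IsRISpace.exists_repr (hι : IsRISpace ι) {f : ℝ → ℝ} (hf : BddSupp f) :
    ∃ u : E, ι u =ᵐ[mPos] f := by
  obtain ⟨C, hC⟩ := hf.bdd
  obtain ⟨B, hB⟩ := hf.supp
  obtain ⟨u, hu⟩ := hι.exists_chi B
  obtain ⟨v, hv, -⟩ := hι.exists_of_dst hf.meas (repr_smul hu C) (fun τ _ => dst_mono (by
    have h1 : ∀ᵐ s ∂mPos, s ∈ Set.Ioi (0 : ℝ) := ae_restrict_mem measurableSet_Ioi
    filter_upwards [h1] with s hs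
    have hC0 : 0 ≤ C := (abs_nonneg _).trans (hC s)
    by_cases h : s < B
    · rw [chi_of_mem hs h, mul_one, abs_of_nonneg hC0]; exact hC s
    · rw [hB s (not_lt.1 h), abs_zero]; exact abs_nonneg _) τ)
  exact ⟨v, hv⟩

open Classical in
/-- The norm of the space as a function on functions `ℝ → ℝ` (zero outside of the space). -/
def nrm (ι : E →ₗ[ℝ] S) (f : ℝ → ℝ) : ℝ :=
  if h : ∃ u : E, ι u =ᵐ[mPos] f then ‖h.choose‖ else 0

lemma IsRISpace.nrm_eq (hι : IsRISpace ι) {u : E} {f : ℝ → ℝ} (h : ι u =ᵐ[mPos] f) :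
    nrm ι f = ‖u‖ := by
  have hex : ∃ u : E, ι u =ᵐ[mPos] f := ⟨u, h⟩
  rw [nrm, dif_pos hex]
  congr 1
  exact hι.injective (AEEqFun.ext (hex.choose_spec.trans h.symm))

lemma nrm_nonneg (f : ℝ → ℝ) : 0 ≤ nrm ι f := by
  unfold nrm; split_ifs <;> simp

lemma IsRISpace.nrm_le_of_dst (hι : IsRISpace ι) {f g : ℝ → ℝ} (hf : BddSupp f) (hg : BddSupp g)
    (h : ∀ τ, 0 ≤ τ → dst f τ ≤ dst g τ) : nrm ι f ≤ nrm ι g := by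
  obtain ⟨u, hu⟩ := hι.exists_repr hg
  obtain ⟨v, hv, hn⟩ := hι.exists_of_dst hf.meas hu h
  rwa [hι.nrm_eq hu, hι.nrm_eq hv]

lemma IsRISpace.nrm_eq_of_dst (hι : IsRISpace ι) {f g : ℝ → ℝ} (hf : BddSupp f) (hg : BddSupp g)
    (h : ∀ τ, 0 ≤ τ → dst f τ = dst g τ) : nrm ι f = nrm ι g :=
  le_antisymm (hι.nrm_le_of_dst hf hg fun τ hτ => (h τ hτ).le)
    (hι.nrm_le_of_dst hg hf fun τ hτ => (h τ hτ).ge)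

lemma IsRISpace.nrm_mono (hι : IsRISpace ι) {f g : ℝ → ℝ} (hf : BddSupp f) (hg : BddSupp g)
    (h : ∀ t, 0 < t → |f t| ≤ |g t|) : nrm ι f ≤ nrm ι g :=
  hι.nrm_le_of_dst hf hg fun τ _ => dst_mono (by
    have h1 : ∀ᵐ s ∂mPos, s ∈ Set.Ioi (0 : ℝ) := ae_restrict_mem measurableSet_Ioi
    filter_upwards [h1] with s hs using h s hs) τ

lemma IsRISpace.nrm_mono_of_nonneg (hι : IsRISpace ι) {f g : ℝ → ℝ} (hf : BddSupp f)
    (hg : BddSupp g) (h0 : ∀ t, 0 ≤ f t) (h : ∀ t, 0 < t → f t ≤ g t) : nrm ι f ≤ nrm ι g :=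
  hι.nrm_mono hf hg fun t ht => by
    rw [abs_of_nonneg (h0 t)]; exact (h t ht).trans (le_abs_self _)

lemma IsRISpace.nrm_add (hι : IsRISpace ι) {f g : ℝ → ℝ} (hf : BddSupp f) (hg : BddSupp g) :
    nrm ι (fun t => f t + g t) ≤ nrm ι f + nrm ι g := by
  obtain ⟨u, hu⟩ := hι.exists_repr hf
  obtain ⟨v, hv⟩ := hι.exists_repr hg
  rw [hι.nrm_eq hu, hι.nrm_eq hv, hι.nrm_eq (repr_add hu hv)]
  exact norm_add_le _ _

lemma IsRISpace.nrm_const_mul (hι : IsRISpace ι) {f : ℝ → ℝ} (hf : BddSupp f) (c : ℝ) :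
    nrm ι (fun t => c * f t) = |c| * nrm ι f := by
  obtain ⟨u, hu⟩ := hι.exists_repr hf
  rw [hι.nrm_eq hu, hι.nrm_eq (repr_smul hu c), norm_smul, Real.norm_eq_abs]

lemma IsRISpace.nrm_sum (hι : IsRISpace ι) {κ : Type*} (s : Finset κ) {f : κ → ℝ → ℝ}
    (hf : ∀ k ∈ s, BddSupp (f k)) : nrm ι (fun t => ∑ k ∈ s, f k t) ≤ ∑ k ∈ s, nrm ι (f k) := by
  have h : ∀ k, ∃ u : E, k ∈ s → ι u =ᵐ[mPos] f k := fun k => by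
    by_cases hk : k ∈ s
    · obtain ⟨u, hu⟩ := hι.exists_repr (hf k hk); exact ⟨u, fun _ => hu⟩
    · exact ⟨0, fun h => absurd h hk⟩
  choose u hu using h
  rw [hι.nrm_eq (repr_sum s hu), Finset.sum_congr rfl fun k hk => hι.nrm_eq (hu k hk)]
  exact norm_sum_le _ _

lemma IsRISpace.nrm_shift (hι : IsRISpace ι) {f : ℝ → ℝ} (hf : BddSupp f) {d : ℝ} (hd : 0 ≤ d) :
    nrm ι (fun t => f (t - d)) = nrm ι f :=
  hι.nrm_eq_of_dst (hf.shift hd) hf fun _ hτ => dst_shift hf.neg hd hτ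

lemma IsRISpace.fundamentalFunction_eq (hι : IsRISpace ι) (t : ℝ) :
    fundamentalFunction ι t = nrm ι (chi t) := by
  obtain ⟨u, hu⟩ := hι.exists_chi t
  have hu' : ι u = charFn (Set.Ioo 0 t) measurableSet_Ioo :=
    AEEqFun.ext (hu.trans (AEEqFun.coeFn_mk _ _).symm)
  rw [hι.nrm_eq hu, fundamentalFunction, extNorm]
  have : (⨅ (v : E) (_ : ι v = charFn (Set.Ioo 0 t) measurableSet_Ioo), ‖v‖ₑ) = ‖u‖ₑ := by
    apply le_antisymm
    · exact iInf_le_of_le u (iInf_le_of_le hu' le_rfl)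
    · refine le_iInf fun v => le_iInf fun hv => ?_
      rw [hι.injective (hv.trans hu'.symm)]
  rw [this]; simp

lemma IsRISpace.nrm_chi_mono (hι : IsRISpace ι) {s t : ℝ} (h : s ≤ t) :
    nrm ι (chi s) ≤ nrm ι (chi t) :=
  hι.nrm_le_of_dst (.chi s) (.chi t) fun τ _ => dst_chi_mono h τ

lemma IsRISpace.nrm_chi_two_mul (hι : IsRISpace ι) {t : ℝ} (ht : 0 < t) :
    nrm ι (chi (2 * t)) ≤ 2 * nrm ι (chi t) := by
  obtain ⟨u, hu⟩ := hι.exists_repr (BddSupp.chi t)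
  obtain ⟨v, hv⟩ := hι.exists_repr ((BddSupp.chi t).shift ht.le)
  have h : ι (u + v) =ᵐ[mPos] chi (2 * t) := by
    filter_upwards [repr_add hu hv, chi_two_mul_ae ht] with s h1 h2
    rw [h1, h2]
  have h3 := hι.nrm_shift (BddSupp.chi t) ht.le
  rw [hι.nrm_eq hu, hι.nrm_eq hv] at h3
  rw [hι.nrm_eq h, hι.nrm_eq hu]
  linarith [norm_add_le u v]

lemma IsRISpace.nrm_chi_two_pow_mul (hι : IsRISpace ι) {t : ℝ} (ht : 0 < t) (n : ℕ) :
    nrm ι (chi (2 ^ n * t)) ≤ 2 ^ n * nrm ι (chi t) := by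
  induction n with
  | zero => simp
  | succ n ih =>
    have := hι.nrm_chi_two_mul (t := 2 ^ n * t) (by positivity)
    rw [pow_succ', mul_assoc]
    linarith

lemma IsRISpace.nrm_chi_pos (hι : IsRISpace ι) {t : ℝ} (ht : 0 < t) : 0 < nrm ι (chi t) := by
  obtain ⟨x, hx⟩ := hι.exists_chi t
  rw [hι.nrm_eq hx, norm_pos_iff]
  rintro rfl
  have h := distrib_eq_dst hx (1 / 2)
  rw [distrib_eq_dst (repr_zero ι), dst_chi_of_lt (by norm_num) (by norm_num)] at h
  have h0 : dst (fun _ => (0 : ℝ)) (1 / 2) = 0 := by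
    have : ¬ ((1 / 2 : ℝ) < |0|) := by norm_num
    simp [dst, this, -one_div, -abs_zero]
  rw [h0, eq_comm, ENNReal.ofReal_eq_zero] at h
  linarith

end

/-! ### Truncated primitives and their behaviour under dilation. -/

/-- The truncated primitive `t ↦ ∫ k` over `[max a t, b]`, extended by zero to `(-∞, 0]`. -/
def primitiveBetween (k : ℝ → ℝ) (a b t : ℝ) : ℝ :=
  if 0 < t then ∫ s in (max a (min t b))..b, k s else 0

section Primitive

variable {k : ℝ → ℝ} (hk : ContinuousOn k (Set.Ioi 0)) (hk0 : ∀ s, 0 < s → 0 ≤ k s)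

include hk in
lemma intervalIntegrable_of_pos {x y : ℝ} (hx : 0 < x) (hy : 0 < y) :
    IntervalIntegrable k volume x y :=
  (hk.mono fun _ hs => lt_of_lt_of_le (lt_min hx hy) hs.1).intervalIntegrable

include hk0 in
lemma integral_nonneg_of_pos {x y : ℝ} (hx : 0 < x) (hxy : x ≤ y) : 0 ≤ ∫ s in x..y, k s :=
  intervalIntegral.integral_nonneg hxy fun s hs => hk0 s (hx.trans_le hs.1)

include hk hk0 in
lemma integral_mono_of_pos {x y x' y' : ℝ} (hx' : 0 < x') (h1 : x' ≤ x) (h2 : x ≤ y)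
    (h3 : y ≤ y') : ∫ s in x..y, k s ≤ ∫ s in x'..y', k s := by
  have hx : 0 < x := hx'.trans_le h1
  have hy : 0 < y := hx.trans_le h2
  have hy' : 0 < y' := hy.trans_le h3
  rw [← intervalIntegral.integral_add_adjacent_intervals (intervalIntegrable_of_pos hk hx' hx)
    (intervalIntegrable_of_pos hk hx hy'), ← intervalIntegral.integral_add_adjacent_intervals
    (intervalIntegrable_of_pos hk hx hy) (intervalIntegrable_of_pos hk hy hy')]
  linarith [integral_nonneg_of_pos hk0 hx' h1, integral_nonneg_of_pos hk0 hy h3]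

variable {a b : ℝ} (ha : 0 < a) (hab : a ≤ b)

lemma primitiveBetween_of_nonpos {t : ℝ} (ht : t ≤ 0) : primitiveBetween k a b t = 0 :=
  if_neg ht.not_gt

include hab in
lemma primitiveBetween_of_le {t : ℝ} (ht : b ≤ t) : primitiveBetween k a b t = 0 := by
  unfold primitiveBetween
  split_ifs
  · rw [min_eq_right ht, max_eq_right hab, intervalIntegral.integral_same]
  · rfl

include hk0 ha hab in
lemma primitiveBetween_nonneg (t : ℝ) : 0 ≤ primitiveBetween k a b t := by
  unfold primitiveBetween
  split_ifs
  · exact integral_nonneg_of_pos hk0 (ha.trans_le (le_max_left _ _))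
      (max_le hab (min_le_right _ _))
  · rfl

include hk hk0 ha hab in
lemma primitiveBetween_anti {s t : ℝ} (hs : 0 < s) (hst : s ≤ t) :
    primitiveBetween k a b t ≤ primitiveBetween k a b s := by
  rw [primitiveBetween, primitiveBetween, if_pos hs, if_pos (hs.trans_le hst)]
  exact integral_mono_of_pos hk hk0 (ha.trans_le (le_max_left _ _))
    (max_le_max le_rfl (min_le_min hst le_rfl)) (max_le hab (min_le_right _ _)) le_rfl

include hk ha hab in
-- The Lipschitz constant is a bound for `k` on the compact interval `[a, b]`. The restriction to `s
-- > 0` is needed, since the function may jump at `0`.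
lemma primitiveBetween_sub_le : ∃ L, 0 ≤ L ∧ ∀ s t, 0 < s → s ≤ t →
    primitiveBetween k a b s - primitiveBetween k a b t ≤ L * (t - s) := by
  have hc : ContinuousOn k (Set.Icc a b) := hk.mono fun x hx => ha.trans_le hx.1
  obtain ⟨L, hL⟩ := isCompact_Icc.exists_bound_of_continuousOn hc
  have hL0 : 0 ≤ L := (norm_nonneg _).trans (hL a ⟨le_rfl, hab⟩)
  refine ⟨L, hL0, fun s t hs hst => ?_⟩
  rw [primitiveBetween, primitiveBetween, if_pos hs, if_pos (hs.trans_le hst)]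
  set x := max a (min s b)
  set y := max a (min t b)
  have hx : 0 < x := ha.trans_le (le_max_left _ _)
  have hxy : x ≤ y := max_le_max le_rfl (min_le_min hst le_rfl)
  have hyb : y ≤ b := max_le hab (min_le_right _ _)
  have hax : a ≤ x := le_max_left _ _
  have hy := hx.trans_le hxy
  rw [← intervalIntegral.integral_add_adjacent_intervals (intervalIntegrable_of_pos hk hx hy)
    (intervalIntegrable_of_pos hk hy (hy.trans_le hyb)), add_sub_cancel_right]
  have h1 : ‖∫ u in x..y, k u‖ ≤ L * |y - x| :=
    intervalIntegral.norm_integral_le_of_norm_le_const fun u hu => by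
      rw [Set.uIoc_of_le hxy] at hu
      exact hL u ⟨hax.trans hu.1.le, hu.2.trans hyb⟩
  refine (Real.le_norm_self _).trans (h1.trans (mul_le_mul_of_nonneg_left ?_ hL0))
  rw [abs_of_nonneg (sub_nonneg.2 hxy)]
  have e1 : |y - x| ≤ |min t b - min s b| := by
    have := abs_max_sub_max_le_max a (min t b) a (min s b)
    simpa [x, y] using this
  have e2 : |min t b - min s b| ≤ |t - s| := by
    have := abs_min_sub_min_le_max t b s b
    simpa using this
  rw [abs_of_nonneg (sub_nonneg.2 hst)] at e2
  exact (le_abs_self _).trans (e1.trans e2)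

include hk hk0 ha hab in
lemma primitiveBetween_le (t : ℝ) : primitiveBetween k a b t ≤ ∫ s in a..b, k s := by
  unfold primitiveBetween
  split_ifs
  · exact integral_mono_of_pos hk hk0 ha (le_max_left _ _) (max_le hab (min_le_right _ _)) le_rfl
  · exact integral_nonneg_of_pos hk0 ha hab

include hk hk0 ha hab in
lemma bddSupp_primitiveBetween : BddSupp (primitiveBetween k a b) := by
  refine ⟨?_, fun t ht => primitiveBetween_of_nonpos ht.le, ⟨∫ s in a..b, k s, fun t => ?_⟩,
    ⟨b, fun t ht => primitiveBetween_of_le hab ht⟩⟩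
  · unfold primitiveBetween
    refine Measurable.ite measurableSet_Ioi ?_ measurable_const
    have : Antitone fun t => ∫ s in (max a (min t b))..b, k s := fun s t hst =>
      integral_mono_of_pos hk hk0 (ha.trans_le (le_max_left _ _))
        (max_le_max le_rfl (min_le_min hst le_rfl)) (max_le hab (min_le_right _ _)) le_rfl
    exact this.measurable
  · rw [abs_of_nonneg (primitiveBetween_nonneg hk0 ha hab t)]
    exact primitiveBetween_le hk hk0 ha hab t

lemma integral_eq_dilate (k : ℝ → ℝ) {N : ℝ} (hN : 0 < N) (x y : ℝ) :
    ∫ s in x..y, k s = ∫ s in (N * x)..(N * y), k (s / N) / N := by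
  rw [intervalIntegral.integral_div, intervalIntegral.integral_comp_div k hN.ne',
    mul_div_cancel_left₀ _ hN.ne', mul_div_cancel_left₀ _ hN.ne', smul_eq_mul,
    mul_div_cancel_left₀ _ hN.ne']

include hk in
lemma intervalIntegrable_dilate {N x y : ℝ} (hN : 0 < N) (hx : 0 < x) (hy : 0 < y) :
    IntervalIntegrable (fun s => k (s / N) / N) volume x y := by
  apply intervalIntegrable_of_pos _ hx hy
  refine ContinuousOn.div_const (hk.comp (continuous_id.div_const N).continuousOn fun s hs => ?_) _
  exact div_pos hs hN

include hk hk0 ha hab in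
-- Substituting `s / N` for `s` gives an integral with upper end `N * b ≤ b`, whose lower end can go
-- below `max a t` only when `t < a`. The excess is then covered by the integral over `[N * a, a]`.
lemma primitiveBetween_dilate_le {N M : ℝ} (hN : 0 < N) (hN1 : N ≤ 1) (hM0 : 0 ≤ M)
    (hM : ∀ s, 0 < s → k (s / N) / N ≤ M * k s) (t : ℝ) :
    primitiveBetween k a b (t / N) ≤
      M * (primitiveBetween k a b t + (∫ s in (N * a)..a, k s) * chi a t) := by
  have hNa : N * a ≤ a := mul_le_of_le_one_left ha.le hN1
  have hNa0 : 0 < N * a := mul_pos hN ha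
  have hb : 0 < b := ha.trans_le hab
  have hNb : N * b ≤ b := mul_le_of_le_one_left hb.le hN1
  rcases le_or_gt t 0 with ht | ht
  · rw [primitiveBetween_of_nonpos ht,
      primitiveBetween_of_nonpos (div_nonpos_of_nonpos_of_nonneg ht hN.le)]
    have := integral_nonneg_of_pos hk0 hNa0 hNa
    have := chi_nonneg a t
    positivity
  have htN : 0 < t / N := div_pos ht hN
  set x := max a (min (t / N) b) with hx
  have hx0 : 0 < x := ha.trans_le (le_max_left _ _)
  have hxb : x ≤ b := max_le hab (min_le_right _ _)
  have hNx0 : 0 < N * x := mul_pos hN hx0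
  have hNxb : N * x ≤ N * b := mul_le_mul_of_nonneg_left hxb hN.le
  have h1 : primitiveBetween k a b (t / N) ≤ M * ∫ s in (N * x)..(N * b), k s := by
    rw [primitiveBetween, if_pos htN, integral_eq_dilate k hN (max a (min (t / N) b)) b,
      ← intervalIntegral.integral_const_mul]
    exact intervalIntegral.integral_mono_on hNxb
      (intervalIntegrable_dilate hk hN hNx0 (mul_pos hN hb))
      ((intervalIntegrable_of_pos hk hNx0 (mul_pos hN hb)).const_mul M)
      fun s hs => hM s (hNx0.trans_le hs.1)
  refine h1.trans (mul_le_mul_of_nonneg_left ?_ hM0)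
  rcases lt_or_ge t a with hta | hta
  · rw [chi_of_mem ht hta, mul_one, primitiveBetween, if_pos ht, min_eq_left (hta.le.trans hab),
      max_eq_left hta.le, add_comm, intervalIntegral.integral_add_adjacent_intervals
        (intervalIntegrable_of_pos hk hNa0 ha) (intervalIntegrable_of_pos hk ha hb)]
    exact integral_mono_of_pos hk hk0 hNa0 (mul_le_mul_of_nonneg_left (le_max_left _ _) hN.le)
      hNxb hNb
  · have h2 : 0 ≤ (∫ s in (N * a)..a, k s) * chi a t :=
      mul_nonneg (integral_nonneg_of_pos hk0 hNa0 hNa) (chi_nonneg _ _)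
    suffices h : ∫ s in (N * x)..(N * b), k s ≤ primitiveBetween k a b t by linarith
    rcases le_or_gt b (t / N) with hbt | hbt
    · have : x = b := by rw [hx, min_eq_right hbt, max_eq_right hab]
      rw [this, intervalIntegral.integral_same]
      exact primitiveBetween_nonneg hk0 ha hab t
    · have htb : t ≤ b := by
        rw [div_lt_iff₀ hN, mul_comm] at hbt; linarith
      rw [primitiveBetween, if_pos ht, min_eq_left htb, max_eq_right hta]
      refine integral_mono_of_pos hk hk0 ht ?_ hNxb hNb
      rw [hx, min_eq_left hbt.le]
      calc t = N * (t / N) := by field_simp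
        _ ≤ _ := mul_le_mul_of_nonneg_left (le_max_right _ _) hN.le

include hk hk0 ha hab in
-- For the reverse comparison the substituted integral stops at `N * b`, so the loss is at most the
-- integral over `[N * b, b]`.
lemma le_primitiveBetween_dilate {N m : ℝ} (hN : 0 < N) (hN1 : N ≤ 1) (hm0 : 0 ≤ m)
    (hm : ∀ s, 0 < s → m * k s ≤ k (s / N) / N) (t : ℝ) :
    m * (primitiveBetween k a b t - (∫ s in (N * b)..b, k s) * chi b t) ≤
      primitiveBetween k a b (t / N) := by
  have hb : 0 < b := ha.trans_le hab
  have hNb : N * b ≤ b := mul_le_of_le_one_left hb.le hN1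
  have hNb0 : 0 < N * b := mul_pos hN hb
  have h0 := primitiveBetween_nonneg hk0 ha hab (t / N)
  have hI := integral_nonneg_of_pos hk0 hNb0 hNb
  rcases le_or_gt t 0 with ht | ht
  · rw [primitiveBetween_of_nonpos ht]
    have := chi_nonneg b t
    have : 0 ≤ m * ((∫ s in (N * b)..b, k s) * chi b t) := by positivity
    linarith
  rcases le_or_gt b t with htb | htb
  · rw [primitiveBetween_of_le hab htb]
    have := chi_nonneg b t
    have : 0 ≤ m * ((∫ s in (N * b)..b, k s) * chi b t) := by positivity
    linarith
  have htN : 0 < t / N := div_pos ht hN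
  set x := max a (min (t / N) b) with hx
  have hx0 : 0 < x := ha.trans_le (le_max_left _ _)
  have hxb : x ≤ b := max_le hab (min_le_right _ _)
  have hNx0 : 0 < N * x := mul_pos hN hx0
  have hNxb : N * x ≤ N * b := mul_le_mul_of_nonneg_left hxb hN.le
  have h1 : m * ∫ s in (N * x)..(N * b), k s ≤ primitiveBetween k a b (t / N) := by
    rw [primitiveBetween, if_pos htN, integral_eq_dilate k hN (max a (min (t / N) b)) b,
      ← intervalIntegral.integral_const_mul]
    exact intervalIntegral.integral_mono_on hNxb
      ((intervalIntegrable_of_pos hk hNx0 hNb0).const_mul m)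
      (intervalIntegrable_dilate hk hN hNx0 hNb0)
      fun s hs => hm s (hNx0.trans_le hs.1)
  refine (mul_le_mul_of_nonneg_left ?_ hm0).trans h1
  rw [chi_of_mem ht htb, mul_one, sub_le_iff_le_add,
    intervalIntegral.integral_add_adjacent_intervals
      (intervalIntegrable_of_pos hk hNx0 hNb0) (intervalIntegrable_of_pos hk hNb0 hb),
    primitiveBetween, if_pos ht]
  refine integral_mono_of_pos hk hk0 hNx0 ?_ (max_le hab (min_le_right _ _)) le_rfl
  have e : N * (t / N) = t := by field_simp
  rw [hx, mul_max_of_nonneg _ _ hN.le, mul_min_of_nonneg _ _ hN.le, e]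
  exact max_le_max (mul_le_of_le_one_left ha.le hN1) (min_le_min le_rfl hNb)

end Primitive

/-! ### The damped power weight. -/

/-- The weight `min ((s/c)^e, (c/s)^e) s^(-θ-1)`. -/
def hatWeight (θ e c s : ℝ) : ℝ := min ((s / c) ^ e) ((c / s) ^ e) * s ^ (-θ - 1)

section HatWeight

variable {θ e c : ℝ} (hc : 0 < c)

include hc in
lemma continuousOn_hatWeight : ContinuousOn (hatWeight θ e c) (Set.Ioi 0) := by
  unfold hatWeight
  have hne : ∀ s ∈ Set.Ioi (0 : ℝ), s ≠ 0 := fun s hs => (Set.mem_Ioi.1 hs).ne'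
  refine ContinuousOn.mul (ContinuousOn.inf ?_ ?_) ?_
  · exact ContinuousOn.rpow_const (continuousOn_id.div_const c)
      fun s hs => Or.inl (div_pos hs hc).ne'
  · exact ContinuousOn.rpow_const (continuousOn_const.div continuousOn_id hne)
      fun s hs => Or.inl (div_pos hc hs).ne'
  · exact ContinuousOn.rpow_const continuousOn_id fun s hs => Or.inl (hne s hs)

include hc in
lemma hatWeight_nonneg {s : ℝ} (hs : 0 < s) : 0 ≤ hatWeight θ e c s := by
  unfold hatWeight; positivity

include hc in
lemma hatWeight_dilate {N s : ℝ} (hN : 0 < N) (hs : 0 < s) :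
    hatWeight θ e c (s / N) / N =
      N ^ θ * (min ((s / c) ^ e * N ^ (-e)) ((c / s) ^ e * N ^ e) * s ^ (-θ - 1)) := by
  have h1 : (s / N / c) ^ e = (s / c) ^ e * N ^ (-e) := by
    rw [Real.rpow_neg hN.le, ← div_eq_mul_inv, ← Real.div_rpow (by positivity) hN.le]
    congr 1; field_simp
  have h2 : (c / (s / N)) ^ e = (c / s) ^ e * N ^ e := by
    rw [← Real.mul_rpow (by positivity) hN.le]
    congr 1; field_simp
  have h3 : (s / N) ^ (-θ - 1) = s ^ (-θ - 1) * (N ^ θ * N) := by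
    rw [Real.div_rpow hs.le hN.le, div_eq_mul_inv, ← Real.rpow_neg hN.le]
    congr 1
    rw [← Real.rpow_add_one hN.ne']
    congr 1; ring
  rw [hatWeight, h1, h2, h3]
  field_simp

include hc in
-- The pure power contributes exactly `N ^ θ`; the two branches of the minimum are multiplied by `N
-- ^ (-e)` and `N ^ e`, both at most `N ^ (-e)`.
lemma hatWeight_dilate_le (he : 0 ≤ e) {N s : ℝ} (hN : 0 < N) (hN1 : N ≤ 1) (hs : 0 < s) :
    hatWeight θ e c (s / N) / N ≤ N ^ (θ - e) * hatWeight θ e c s := by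
  rw [hatWeight_dilate hc hN hs, hatWeight, sub_eq_add_neg θ e, Real.rpow_add hN, mul_assoc]
  refine mul_le_mul_of_nonneg_left ?_ (by positivity)
  rw [← mul_assoc]
  refine mul_le_mul_of_nonneg_right ?_ (by positivity)
  have h1 : N ^ e ≤ N ^ (-e) := Real.rpow_le_rpow_of_exponent_ge hN hN1 (by linarith)
  rw [mul_min_of_nonneg _ _ (by positivity)]
  refine min_le_min (by rw [mul_comm]) ?_
  rw [mul_comm]
  exact mul_le_mul_of_nonneg_right h1 (by positivity)

include hc in
lemma le_hatWeight_dilate (he : 0 ≤ e) {N s : ℝ} (hN : 0 < N) (hN1 : N ≤ 1) (hs : 0 < s) :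
    N ^ (θ + e) * hatWeight θ e c s ≤ hatWeight θ e c (s / N) / N := by
  rw [hatWeight_dilate hc hN hs, hatWeight, Real.rpow_add hN, mul_assoc]
  refine mul_le_mul_of_nonneg_left ?_ (by positivity)
  rw [← mul_assoc]
  refine mul_le_mul_of_nonneg_right ?_ (by positivity)
  have h1 : N ^ e ≤ N ^ (-e) := Real.rpow_le_rpow_of_exponent_ge hN hN1 (by linarith)
  rw [mul_min_of_nonneg _ _ (by positivity)]
  refine min_le_min ?_ (by rw [mul_comm])
  rw [mul_comm]
  exact mul_le_mul_of_nonneg_left h1 (by positivity)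

lemma integral_le_of_le {k : ℝ → ℝ} (hk : ContinuousOn k (Set.Ioi 0)) {x y C : ℝ} (hx : 0 < x)
    (hxy : x ≤ y) (hC0 : 0 ≤ C) (hC : ∀ s, x ≤ s → s ≤ y → k s ≤ C) :
    ∫ s in x..y, k s ≤ C * y := by
  have h := intervalIntegral.integral_mono_on hxy
    (intervalIntegrable_of_pos hk hx (hx.trans_le hxy)) intervalIntegrable_const
    (g := fun _ => C) fun s hs => hC s hs.1 hs.2
  rw [intervalIntegral.integral_const, smul_eq_mul] at h
  nlinarith

include hc in
-- A crude supremum bound suffices: the cut-off error at `a` need only be a constant depending on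
-- `η` times the quantity that `DecaysBothSides` makes small.
lemma integral_hatWeight_le_left (hθ : 0 ≤ θ) (he : 0 ≤ e) {η a : ℝ} (hη : 0 < η) (hη1 : η ≤ 1)
    (ha : 0 < a) : ∫ s in (η * a)..a, hatWeight θ e c s ≤
      η ^ (-θ - 1) * ((a / c) ^ e * a ^ (-θ)) := by
  have hηa : 0 < η * a := mul_pos hη ha
  refine (integral_le_of_le (C := (a / c) ^ e * (η * a) ^ (-θ - 1)) (continuousOn_hatWeight hc)
    hηa (mul_le_of_le_one_left ha.le hη1) (by positivity) fun s h1 h2 => ?_).trans_eq ?_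
  · have hs : 0 < s := hηa.trans_le h1
    refine mul_le_mul ((min_le_left _ _).trans ?_) ?_ (by positivity) (by positivity)
    · exact Real.rpow_le_rpow (by positivity) (by gcongr) he
    · exact Real.rpow_le_rpow_of_nonpos hηa h1 (by linarith)
  · rw [Real.mul_rpow hη.le ha.le, Real.rpow_sub_one ha.ne']
    field_simp

include hc in
lemma integral_hatWeight_le_right (hθ : 0 ≤ θ) (he : 0 ≤ e) {η b : ℝ} (hη : 0 < η) (hη1 : η ≤ 1)
    (hb : 0 < b) : ∫ s in (η * b)..b, hatWeight θ e c s ≤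
      η ^ (-θ - e - 1) * ((c / b) ^ e * b ^ (-θ)) := by
  have hηb : 0 < η * b := mul_pos hη hb
  refine (integral_le_of_le (C := (c / (η * b)) ^ e * (η * b) ^ (-θ - 1))
    (continuousOn_hatWeight hc)
    hηb (mul_le_of_le_one_left hb.le hη1) (by positivity) fun s h1 h2 => ?_).trans_eq ?_
  · have hs : 0 < s := hηb.trans_le h1
    refine mul_le_mul ((min_le_right _ _).trans ?_) ?_ (by positivity) (by positivity)
    · exact Real.rpow_le_rpow (by positivity) (by gcongr) he
    · exact Real.rpow_le_rpow_of_nonpos hηb h1 (by linarith)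
  · have h1 : (c / (η * b)) ^ e = (c / b) ^ e * η ^ (-e) := by
      rw [Real.rpow_neg hη.le, ← div_eq_mul_inv, ← Real.div_rpow (by positivity) hη.le]
      congr 1; field_simp
    have h2 : η ^ (-θ - e - 1) = η ^ (-e) * η ^ (-θ - 1) := by
      rw [← Real.rpow_add hη]; congr 1; ring
    rw [Real.mul_rpow hη.le hb.le, Real.rpow_sub_one hb.ne', h1, h2]
    field_simp

include hc in
-- On `[c, 2c]` the damping factor is at least `1/2`, because `e ≤ 1`. This yields the lower bound
-- for the norm of the primitive against which cut-off errors are measured.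
lemma le_integral_hatWeight (hθ : 0 ≤ θ) (he : 0 ≤ e) (he1 : e ≤ 1) :
    2 ^ (-θ - 2) * c ^ (-θ) ≤ ∫ s in c..(2 * c), hatWeight θ e c s := by
  have hcc : c ≤ 2 * c := by linarith
  have h := intervalIntegral.integral_mono_on hcc intervalIntegrable_const
    (intervalIntegrable_of_pos (continuousOn_hatWeight (θ := θ) (e := e) hc) hc
      (hc.trans_le hcc)) (f := fun _ => (1 / 2) * (2 * c) ^ (-θ - 1)) fun s hs => ?_
  · rw [intervalIntegral.integral_const, smul_eq_mul] at h
    refine le_trans (le_of_eq ?_) h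
    rw [Real.mul_rpow two_pos.le hc.le, Real.rpow_sub_one hc.ne',
      show -θ - 2 = (-θ - 1) - 1 by ring, Real.rpow_sub_one two_ne_zero (-θ - 1)]
    field_simp
    ring
  · have hs0 : 0 < s := hc.trans_le hs.1
    refine mul_le_mul (le_min ?_ ?_) ?_ (by positivity) (by positivity)
    · have : (1 : ℝ) ≤ (s / c) ^ e := Real.one_le_rpow ((one_le_div hc).2 hs.1) he
      linarith
    · have h2 : 1 / 2 ≤ c / s := by
        rw [div_le_div_iff₀ two_pos hs0]; linarith [hs.2]
      have h3 : c / s ≤ 1 := (div_le_one hs0).2 hs.1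
      calc (1 / 2 : ℝ) ≤ c / s := h2
        _ = (c / s) ^ (1 : ℝ) := (Real.rpow_one _).symm
        _ ≤ (c / s) ^ e := Real.rpow_le_rpow_of_exponent_ge (by positivity) h3 he1
    · exact Real.rpow_le_rpow_of_nonpos hs0 hs.2 (by linarith)

end HatWeight

/-! ### Construction of almost homogeneous functions. -/

/-- `t ^ (-θ) * φ t`, damped by any small power of the distance from some point `c`, becomes
arbitrarily small on both sides of `c`. -/
def DecaysBothSides (φ : ℝ → ℝ) (θ : ℝ) : Prop :=
  ∀ e : ℝ, 0 < e → ∀ δ : ℝ, 0 < δ → ∃ a c b : ℝ, 0 < a ∧ a ≤ c ∧ c ≤ b ∧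
    φ a * ((a / c) ^ e * a ^ (-θ)) ≤ δ * (φ c * c ^ (-θ)) ∧
    φ b * ((c / b) ^ e * b ^ (-θ)) ≤ δ * (φ c * c ^ (-θ))

section

variable {E : Type*} [NormedAddCommGroup E] [NormedSpace ℝ E] {ι : E →ₗ[ℝ] S}

/-- A decreasing function `F` which the dilations by `N ∈ [η, 1]` map approximately to
`N ^ θ * F`. -/
structure AlmostHomogeneous (ι : E →ₗ[ℝ] S) (θ η κ : ℝ) (F : ℝ → ℝ) (a b A B : ℝ) : Prop where
  bddSupp : BddSupp F
  of_nonpos : ∀ t ≤ 0, F t = 0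
  nonneg : ∀ t, 0 ≤ F t
  anti : ∀ s t, 0 < s → s ≤ t → F t ≤ F s
  lipschitz : ∃ L, 0 ≤ L ∧ ∀ s t, 0 < s → s ≤ t → F s - F t ≤ L * (t - s)
  pos : 0 < b
  of_le : ∀ t, b ≤ t → F t = 0
  nrm_pos : 0 < nrm ι F
  A_nonneg : 0 ≤ A
  B_nonneg : 0 ≤ B
  A_small : A * nrm ι (chi a) ≤ κ * nrm ι F
  B_small : B * nrm ι (chi b) ≤ κ * nrm ι F
  dilate_le : ∀ N t, η ≤ N → N ≤ 1 → F (t / N) ≤ (1 + κ) * N ^ θ * F t + A * chi a t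
  le_dilate : ∀ N t, η ≤ N → N ≤ 1 → N ^ θ * F t ≤ (1 + κ) * F (t / N) + B * chi b t

/-- Continuity at `e = 0`. The bound at `η` then controls `N ^ (-e)` for all `N ∈ [η, 1]`. -/
lemma exists_rpow_neg_le {η κ : ℝ} (hη : 0 < η) (hκ : 0 < κ) :
    ∃ e : ℝ, 0 < e ∧ e ≤ 1 ∧ η ^ (-e) ≤ 1 + κ := by
  have h : Tendsto (fun e : ℝ => η ^ (-e)) (𝓝 0) (𝓝 (η ^ (-(0 : ℝ)))) :=
    ((Real.continuous_const_rpow hη.ne').comp continuous_neg).tendsto 0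
  rw [neg_zero, Real.rpow_zero] at h
  have h1 : ∀ᶠ e in 𝓝[>] (0 : ℝ), η ^ (-e) < 1 + κ :=
    (h.eventually_lt_const (by linarith)).filter_mono nhdsWithin_le_nhds
  have h2 : ∀ᶠ e in 𝓝[>] (0 : ℝ), e ∈ Set.Ioc (0 : ℝ) 1 := Ioc_mem_nhdsGT one_pos
  obtain ⟨e, he1, he2⟩ := (h1.and h2).exists
  exact ⟨e, he2.1, he2.2, he1.le⟩

lemma IsRISpace.exists_almostHomogeneous (hι : IsRISpace ι) {θ η κ : ℝ} (hθ : 0 ≤ θ)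
    (h : DecaysBothSides (fun t => nrm ι (chi t)) θ) (hη : 0 < η) (hη1 : η ≤ 1)
    (hκ : 0 < κ) (hκ1 : κ ≤ 1) :
    ∃ F a b A B, AlmostHomogeneous ι θ η κ F a b A B := by
  obtain ⟨e, he0, he1, he⟩ := exists_rpow_neg_le hη hκ
  set D : ℝ := 2 ^ (-θ - 2) with hD
  set H : ℝ := η ^ (-θ - e - 1) with hH
  have hD0 : 0 < D := by positivity
  have hH0 : 0 < H := by positivity
  have hHA : η ^ (-θ - 1) ≤ H := Real.rpow_le_rpow_of_exponent_ge hη hη1 (by linarith)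
  have hH1 : 1 ≤ H := Real.one_le_rpow_of_pos_of_le_one_of_nonpos hη hη1 (by linarith)
  -- `D * w`, with `w = φ(c) c^(-θ)`, will bound the norm of `F` from below, and `H` bounds the
  -- constants of both cut-off errors. The `2` pays for the factor in `A = 2 * α`.
  obtain ⟨a, c, b, ha, hac, hcb, hA, hB⟩ := h e he0 (κ * D / (2 * H)) (by positivity)
  have hc : 0 < c := ha.trans_le hac
  have hb : 0 < b := hc.trans_le hcb
  have hab : a ≤ b := hac.trans hcb
  have hφc := hι.nrm_chi_pos hc
  set w := nrm ι (chi c) * c ^ (-θ) with hw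
  have hw0 : 0 < w := by positivity
  -- If `b < 2c`, the damped quantity at `b` would be comparable with its value at `c`, against
  -- `hB`. Thus `[c, 2c]` fits below `b` and can be used to bound the norm of `F` from below.
  have h2c : 2 * c ≤ b := by
    by_contra! hcon
    have h1 : 2⁻¹ ≤ c / b := by
      rw [inv_eq_one_div, div_le_div_iff₀ two_pos hb]; linarith
    have h2 : (2⁻¹ : ℝ) ≤ (c / b) ^ e := by
      calc (2⁻¹ : ℝ) ≤ c / b := h1
        _ = (c / b) ^ (1 : ℝ) := (Real.rpow_one _).symm
        _ ≤ (c / b) ^ e := Real.rpow_le_rpow_of_exponent_ge (by positivity)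
          ((div_le_one hb).2 hcb) he1
    have h3 : 2 ^ (-θ) * c ^ (-θ) ≤ b ^ (-θ) := by
      rw [← Real.mul_rpow two_pos.le hc.le]
      exact Real.rpow_le_rpow_of_nonpos hb hcon.le (by linarith)
    have h4 : nrm ι (chi c) * (2⁻¹ * (2 ^ (-θ) * c ^ (-θ))) ≤
        nrm ι (chi b) * ((c / b) ^ e * b ^ (-θ)) := by
      refine mul_le_mul (hι.nrm_chi_mono hcb) (mul_le_mul h2 h3 (by positivity) (by positivity))
        (by positivity) (nrm_nonneg _)
    have h5 : D = 2 ^ (-θ) / 4 := by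
      rw [hD, Real.rpow_sub two_pos]; norm_num
    have h6 : κ * D / (2 * H) ≤ D / 2 := by
      rw [div_le_div_iff₀ (by positivity) two_pos]
      nlinarith [mul_le_mul hκ1 hH1 zero_le_one zero_le_one, mul_pos hκ hD0]
    have h7 := h4.trans (hB.trans (mul_le_mul_of_nonneg_right h6 hw0.le))
    have h8 : nrm ι (chi c) * (2⁻¹ * (2 ^ (-θ) * c ^ (-θ))) = 2 * D * w := by
      rw [h5, hw]; ring
    rw [h8] at h7
    nlinarith [mul_pos hD0 hw0]
  have hk := continuousOn_hatWeight (θ := θ) (e := e) hc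
  have hk0 : ∀ s, 0 < s → 0 ≤ hatWeight θ e c s := fun s hs => hatWeight_nonneg hc hs
  set F := primitiveBetween (hatWeight θ e c) a b with hF
  have hFb : BddSupp F := bddSupp_primitiveBetween hk hk0 ha hab
  have hF0 : ∀ t, 0 ≤ F t := primitiveBetween_nonneg hk0 ha hab
  have hW : D * w ≤ nrm ι F := by
    have h1 : nrm ι (fun t => (D * c ^ (-θ)) * chi c t) ≤ nrm ι F := by
      refine hι.nrm_mono_of_nonneg ((BddSupp.chi c).const_mul _) hFb
        (fun t => mul_nonneg (by positivity) (chi_nonneg _ _)) fun t ht => ?_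
      rcases lt_or_ge t c with htc | htc
      · rw [chi_of_mem ht htc, mul_one]
        refine le_trans ?_ (primitiveBetween_anti hk hk0 ha hab ht htc.le)
        rw [primitiveBetween, if_pos hc, min_eq_left hcb, max_eq_right hac]
        exact (le_integral_hatWeight hc hθ he0.le he1).trans
          (integral_mono_of_pos hk hk0 hc le_rfl (by linarith) h2c)
      · have : chi c t = 0 := by
          rw [chi, Set.indicator_of_notMem]; intro hm; linarith [hm.2]
        rw [this, mul_zero]; exact hF0 t
    rw [hι.nrm_const_mul (.chi c), abs_of_pos (by positivity)] at h1
    calc D * w = D * c ^ (-θ) * nrm ι (chi c) := by rw [hw]; ring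
      _ ≤ _ := h1
  set W := nrm ι F
  have hW0 : 0 < W := lt_of_lt_of_le (by positivity) hW
  have key : H * (κ * D / (2 * H) * w) ≤ κ * W / 2 := by
    have : H * (κ * D / (2 * H) * w) = κ * (D * w) / 2 := by field_simp
    rw [this]
    have := mul_le_mul_of_nonneg_left hW hκ.le
    linarith
  set α := η ^ (-θ - 1) * ((a / c) ^ e * a ^ (-θ)) with hα
  set β := H * ((c / b) ^ e * b ^ (-θ)) with hβ
  have hNe : ∀ N, η ≤ N → N ≤ 1 → N ^ (-e) ≤ 1 + κ := fun N h1 _ =>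
    (Real.rpow_le_rpow_of_nonpos hη h1 (by linarith)).trans he
  have hα0 : 0 ≤ α := by positivity
  have hβ0 : 0 ≤ β := by positivity
  refine ⟨F, a, b, 2 * α, β, hFb, fun t => primitiveBetween_of_nonpos, hF0,
    fun s t => primitiveBetween_anti hk hk0 ha hab, primitiveBetween_sub_le hk ha hab, hb,
    fun t => primitiveBetween_of_le hab, hW0, by positivity, by positivity, ?_, ?_, ?_, ?_⟩
  · have h1 : α * nrm ι (chi a) ≤ H * (κ * D / (2 * H) * w) :=
      calc α * nrm ι (chi a) = η ^ (-θ - 1) * (nrm ι (chi a) * ((a / c) ^ e * a ^ (-θ))) := by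
            rw [hα]; ring
        _ ≤ H * (κ * D / (2 * H) * w) := mul_le_mul hHA hA
            (mul_nonneg (nrm_nonneg _) (by positivity)) hH0.le
    linarith
  · have h1 : β * nrm ι (chi b) ≤ H * (κ * D / (2 * H) * w) :=
      calc β * nrm ι (chi b) = H * (nrm ι (chi b) * ((c / b) ^ e * b ^ (-θ))) := by
            rw [hβ]; ring
        _ ≤ H * (κ * D / (2 * H) * w) := mul_le_mul_of_nonneg_left hB hH0.le
    have : 0 ≤ κ * W := by positivity
    linarith
  · intro N t hN hN1
    have hN0 : 0 < N := hη.trans_le hN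
    have h1 := primitiveBetween_dilate_le hk hk0 ha hab hN0 hN1 (by positivity)
      (fun s hs => hatWeight_dilate_le (θ := θ) hc he0.le hN0 hN1 hs) t
    have h2 : ∫ s in (N * a)..a, hatWeight θ e c s ≤ α :=
      (integral_mono_of_pos hk hk0 (mul_pos hη ha) (mul_le_mul_of_nonneg_right hN ha.le)
        (mul_le_of_le_one_left ha.le hN1) le_rfl).trans
        (integral_hatWeight_le_left hc hθ he0.le hη hη1 ha)
    have h3 : N ^ (θ - e) ≤ (1 + κ) * N ^ θ := by
      rw [sub_eq_add_neg, Real.rpow_add hN0, mul_comm]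
      exact mul_le_mul_of_nonneg_right (hNe N hN hN1) (by positivity)
    have h4 : N ^ θ ≤ 1 := Real.rpow_le_one hN0.le hN1 hθ
    have hχ := chi_nonneg a t
    have h5 := mul_le_mul_of_nonneg_right h2 hχ
    have hs : 0 ≤ F t + α * chi a t := add_nonneg (hF0 t) (by positivity)
    have h6 : (1 + κ) * N ^ θ ≤ 2 := by
      have := mul_le_mul (show 1 + κ ≤ 2 by linarith) h4 (by positivity) two_pos.le
      linarith
    calc F (t / N) ≤ N ^ (θ - e) * (F t + _) := h1
      _ ≤ N ^ (θ - e) * (F t + α * chi a t) := by gcongr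
      _ ≤ (1 + κ) * N ^ θ * (F t + α * chi a t) := mul_le_mul_of_nonneg_right h3 hs
      _ = (1 + κ) * N ^ θ * F t + (1 + κ) * N ^ θ * (α * chi a t) := by ring
      _ ≤ (1 + κ) * N ^ θ * F t + 2 * (α * chi a t) := by gcongr
      _ = _ := by ring
  · intro N t hN hN1
    have hN0 : 0 < N := hη.trans_le hN
    have h1 := le_primitiveBetween_dilate hk hk0 ha hab hN0 hN1 (by positivity)
      (fun s hs => le_hatWeight_dilate (θ := θ) hc he0.le hN0 hN1 hs) t
    have h2 : ∫ s in (N * b)..b, hatWeight θ e c s ≤ β :=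
      (integral_mono_of_pos hk hk0 (mul_pos hη hb) (mul_le_mul_of_nonneg_right hN hb.le)
        (mul_le_of_le_one_left hb.le hN1) le_rfl).trans
        (integral_hatWeight_le_right hc hθ he0.le hη hη1 hb)
    have h4 : N ^ θ ≤ 1 := Real.rpow_le_one hN0.le hN1 hθ
    have hχ := chi_nonneg b t
    have h5 := mul_le_mul_of_nonneg_right h2 hχ
    have h6 : N ^ θ = N ^ (-e) * N ^ (θ + e) := by
      rw [← Real.rpow_add hN0]; congr 1; ring
    have h7 : N ^ (θ + e) * (F t - β * chi b t) ≤ F (t / N) := le_trans (by gcongr) h1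
    have h8 : N ^ θ * (F t - β * chi b t) ≤ (1 + κ) * F (t / N) := by
      rw [h6, mul_assoc]
      exact (mul_le_mul_of_nonneg_left h7 (by positivity)).trans
        (mul_le_mul_of_nonneg_right (hNe N hN hN1) (hF0 _))
    have h9 : N ^ θ * (β * chi b t) ≤ β * chi b t := mul_le_of_le_one_left (by positivity) h4
    linarith

end

/-! ### Disjoint translates and their distribution functions. -/

/-- The sum of the translates of the functions `g k` by `k * d`. -/
def copies {n : ℕ} (d : ℝ) (g : Fin n → ℝ → ℝ) (t : ℝ) : ℝ := ∑ k, g k (t - k * d)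

section Copies

variable {n : ℕ} {d : ℝ} {g h : Fin n → ℝ → ℝ}

lemma BddSupp.copies (hd : 0 ≤ d) (hg : ∀ k, BddSupp (g k)) : BddSupp (copies d g) :=
  BddSupp.sum _ fun k _ => (hg k).shift (by positivity)

lemma eq_of_shift_ne_zero (hd : 0 ≤ d) {f f' : ℝ → ℝ} (hf : ∀ t, f t ≠ 0 → 0 ≤ t ∧ t < d)
    (hf' : ∀ t, f' t ≠ 0 → 0 ≤ t ∧ t < d) {j k : Fin n} {t : ℝ} (hj : f (t - j * d) ≠ 0)
    (hk : f' (t - k * d) ≠ 0) : j = k := by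
  obtain ⟨h1, h2⟩ := hf _ hj
  obtain ⟨h3, h4⟩ := hf' _ hk
  by_contra hne
  rcases lt_or_gt_of_ne hne with hlt | hlt
  · have : (j : ℝ) + 1 ≤ k := by exact_mod_cast hlt
    nlinarith
  · have : (k : ℝ) + 1 ≤ j := by exact_mod_cast hlt
    nlinarith

lemma copies_eq (hd : 0 ≤ d) (hg : ∀ k t, g k t ≠ 0 → 0 ≤ t ∧ t < d) {k : Fin n} {t : ℝ}
    (hk : g k (t - k * d) ≠ 0) : copies d g t = g k (t - k * d) := by
  refine Finset.sum_eq_single k (fun j _ hj => ?_) (by simp)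
  by_contra hne
  exact hj (eq_of_shift_ne_zero hd (hg j) (hg k) hne hk)

lemma abs_copies (hd : 0 ≤ d) (hg : ∀ k t, g k t ≠ 0 → 0 ≤ t ∧ t < d) (t : ℝ) :
    |copies d g t| = copies d (fun k t => |g k t|) t := by
  by_cases h : ∃ k, g k (t - k * d) ≠ 0
  · obtain ⟨k, hk⟩ := h
    rw [copies_eq hd hg hk, copies_eq (g := fun k t => |g k t|) (k := k) hd
      (fun k t ht => hg k t (abs_ne_zero.1 ht)) (abs_ne_zero.2 hk)]
  · push Not at h
    simp [copies, h]

lemma dst_copies (hd : 0 ≤ d) (hb : ∀ k, BddSupp (g k))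
    (hg : ∀ k t, g k t ≠ 0 → 0 ≤ t ∧ t < d) {τ : ℝ} (hτ : 0 ≤ τ) :
    dst (copies d g) τ = ∑ k, dst (g k) τ := by
  have hd' : ∀ k : Fin n, 0 ≤ (k : ℝ) * d := fun k => by positivity
  have h0 : ∀ x : ℝ, τ < |x| → x ≠ 0 := fun x hx h => by
    rw [h, abs_zero] at hx; linarith
  have hset : {s | τ < |copies d g s|} =
      ⋃ k ∈ (Finset.univ : Finset (Fin n)), {s | τ < |g k (s - k * d)|} := by
    ext s
    simp only [Finset.mem_univ, Set.iUnion_true, Set.mem_iUnion, Set.mem_ofPred_eq]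
    constructor
    · intro hs
      by_contra! hc
      obtain ⟨k, -, hk⟩ := Finset.exists_ne_zero_of_sum_ne_zero (h0 _ hs)
      rw [copies_eq hd hg hk] at hs
      exact absurd hs (hc k).not_gt
    · rintro ⟨k, hk⟩
      rwa [copies_eq hd hg (h0 _ hk)]
  rw [dst_eq_volume (BddSupp.copies hd hb).neg hτ, hset, measure_biUnion_finset]
  · refine Finset.sum_congr rfl fun k _ => ?_
    rw [← dst_shift (hb k).neg (hd' k) hτ, dst_eq_volume ((hb k).shift (hd' k)).neg hτ]
  · intro j _ k _ hjk
    refine Set.disjoint_left.2 fun s hj hk => hjk ?_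
    exact eq_of_shift_ne_zero hd (hg j) (hg k) (h0 _ hj) (h0 _ hk)
  · intro k _
    exact measurableSet_lt measurable_const ((hb k).shift (hd' k)).meas.abs

variable {E : Type*} [NormedAddCommGroup E] [NormedSpace ℝ E] {ι : E →ₗ[ℝ] S}

/-- The remainder is handled by the triangle inequality over its `n` translates. This loss is
harmless, since `n` is fixed before the errors are made small. -/
lemma IsRISpace.nrm_copies_le (hι : IsRISpace ι) (hd : 0 ≤ d) (hg : ∀ k, BddSupp (g k))
    (hh : ∀ k, BddSupp (h k)) {r : ℝ → ℝ} (hr : BddSupp r) {C : ℝ} (hC : 0 ≤ C)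
    (hg0 : ∀ k t, 0 ≤ g k t) (hgh : ∀ k t, g k t ≤ C * h k t + r t) :
    nrm ι (copies d g) ≤ C * nrm ι (copies d h) + n * nrm ι r := by
  have hd' : ∀ k : Fin n, 0 ≤ (k : ℝ) * d := fun k => by positivity
  have hr' : ∀ k : Fin n, BddSupp (fun t => r (t - k * d)) := fun k => hr.shift (hd' k)
  have h1 : nrm ι (copies d g) ≤
      nrm ι (fun t => C * copies d h t + ∑ k : Fin n, r (t - k * d)) := by
    refine hι.nrm_mono_of_nonneg (.copies hd hg)
      (((BddSupp.copies hd hh).const_mul C).add (BddSupp.sum _ fun k _ => hr' k))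
      (fun t => Finset.sum_nonneg fun k _ => hg0 k _) fun t _ => ?_
    rw [copies, copies, Finset.mul_sum, ← Finset.sum_add_distrib]
    exact Finset.sum_le_sum fun k _ => hgh k _
  refine h1.trans ((hι.nrm_add ((BddSupp.copies hd hh).const_mul C)
    (BddSupp.sum _ fun k _ => hr' k)).trans ?_)
  rw [hι.nrm_const_mul (.copies hd hh), abs_of_nonneg hC]
  refine add_le_add le_rfl ((hι.nrm_sum _ fun k _ => hr' k).trans_eq ?_)
  rw [Finset.sum_congr rfl fun k _ => hι.nrm_shift hr (hd' k)]
  simp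

/-- This is the source of `ℓ^p`: the disjoint copies have distribution function `∑ N k * dst F = dst
F`, so together they are equimeasurable with `F`. -/
lemma IsRISpace.nrm_copies_dilate (hι : IsRISpace ι) {F : ℝ → ℝ} (hF : BddSupp F)
    (h0 : ∀ t ≤ 0, F t = 0) (hFd : ∀ t, d ≤ t → F t = 0) {N : Fin n → ℝ} (hd : 0 ≤ d)
    (hN0 : ∀ k, 0 ≤ N k) (hN : ∑ k, N k = 1) :
    nrm ι (copies d fun k t => F (t / N k)) = nrm ι F := by
  have hb : ∀ k, BddSupp (fun t => F (t / N k)) := fun k => hF.dilate (h0 0 le_rfl) (hN0 k)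
  have hN1 : ∀ k, N k ≤ 1 := fun k => hN ▸ Finset.single_le_sum (fun j _ => hN0 j)
    (Finset.mem_univ k)
  refine hι.nrm_eq_of_dst (.copies hd hb) hF fun τ hτ => ?_
  rw [dst_copies hd hb ?_ hτ, Finset.sum_congr rfl fun k _ => dst_dilate h0 (hN0 k) hτ,
    ← Finset.sum_mul, ← ENNReal.ofReal_sum_of_nonneg fun k _ => hN0 k, hN, ENNReal.ofReal_one,
    one_mul]
  intro k t ht
  by_contra hc
  apply ht
  rcases (hN0 k).eq_or_lt with h | h
  · rw [← h, div_zero, h0 0 le_rfl]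
  rw [not_and_or, not_le, not_lt] at hc
  rcases hc with hc | hc
  · exact h0 _ (div_neg_of_neg_of_pos hc h).le
  · refine hFd _ (hc.trans ?_)
    rw [le_div_iff₀ h]
    exact mul_le_of_le_one_right (hd.trans hc) (hN1 k)

end Copies

/-! ### Norms of linear combinations of translates of an almost homogeneous function. -/

section

variable {E : Type*} [NormedAddCommGroup E] [NormedSpace ℝ E] {ι : E →ₗ[ℝ] S}
  {θ η κ : ℝ} {F : ℝ → ℝ} {a b A B : ℝ}

lemma AlmostHomogeneous.nrm_remainder (hF : AlmostHomogeneous ι θ η κ F a b A B)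
    (hι : IsRISpace ι) {x y : ℝ} (hx : 0 ≤ x) {C : ℝ} (hC : 0 ≤ C)
    (hy : C * nrm ι (chi y) ≤ κ * nrm ι F) :
    BddSupp (fun t => C * chi y t + x * F t) ∧
      nrm ι (fun t => C * chi y t + x * F t) ≤ (κ + x) * nrm ι F := by
  have h1 := (BddSupp.chi y).const_mul C
  have h2 := hF.bddSupp.const_mul x
  refine ⟨h1.add h2, (hι.nrm_add h1 h2).trans ?_⟩
  rw [hι.nrm_const_mul (.chi y), hι.nrm_const_mul hF.bddSupp, abs_of_nonneg hx, abs_of_nonneg hC]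
  linarith

/-- Replace `N k ^ θ * F` by the dilation `F (· / N k)` and use equimeasurability. Where `N k < η`
almost homogeneity says nothing, but then the copy is at most `η ^ θ * F` and goes into the
remainder. -/
lemma AlmostHomogeneous.nrm_copies_rpow_le (hF : AlmostHomogeneous ι θ η κ F a b A B)
    (hι : IsRISpace ι) (hη : 0 < η) (hκ : 0 ≤ κ) (hθ : 0 ≤ θ) {n : ℕ} {d : ℝ}
    (hd : b ≤ d) {N : Fin n → ℝ} (hN0 : ∀ k, 0 ≤ N k) (hN : ∑ k, N k = 1) :
    nrm ι (copies d fun k t => N k ^ θ * F t) ≤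
      (1 + κ) * nrm ι F + n * ((κ + η ^ θ) * nrm ι F) := by
  have hd0 : 0 ≤ d := hF.pos.le.trans hd
  have hN1 : ∀ k, N k ≤ 1 := fun k => hN ▸ Finset.single_le_sum (fun j _ => hN0 j)
    (Finset.mem_univ k)
  obtain ⟨hr, hrn⟩ := hF.nrm_remainder hι (x := η ^ θ) (by positivity) hF.B_nonneg hF.B_small
  have h := hι.nrm_copies_le hd0 (g := fun k t => N k ^ θ * F t)
    (h := fun k t => F (t / N k)) (C := 1 + κ) (fun k => hF.bddSupp.const_mul _)
    (fun k => hF.bddSupp.dilate (hF.of_nonpos 0 le_rfl) (hN0 k)) hr (by linarith)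
    (fun k t => mul_nonneg (Real.rpow_nonneg (hN0 k) _) (hF.nonneg t)) fun k t => ?_
  · rw [hι.nrm_copies_dilate hF.bddSupp hF.of_nonpos (fun t ht => hF.of_le t (hd.trans ht)) hd0
      hN0 hN] at h
    exact h.trans (add_le_add le_rfl (mul_le_mul_of_nonneg_left hrn (by positivity)))
  · have h2 := hF.nonneg t
    have h3 := hF.nonneg (t / N k)
    rcases le_or_gt η (N k) with hk | hk
    · have h1 := hF.le_dilate (N k) t hk (hN1 k)
      have : 0 ≤ η ^ θ * F t := by positivity
      linarith
    · have h1 : N k ^ θ * F t ≤ η ^ θ * F t :=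
        mul_le_mul_of_nonneg_right (Real.rpow_le_rpow (hN0 k) hk.le hθ) h2
      have h4 : 0 ≤ B * chi b t := mul_nonneg hF.B_nonneg (chi_nonneg _ _)
      have h5 : 0 ≤ (1 + κ) * F (t / N k) := by positivity
      linarith

lemma AlmostHomogeneous.le_nrm_copies_rpow (hF : AlmostHomogeneous ι θ η κ F a b A B)
    (hι : IsRISpace ι) (hη : 0 < η) (hη1 : η ≤ 1) (hκ : 0 ≤ κ) (hκ1 : κ ≤ 1) {n : ℕ}
    {d : ℝ} (hd : b ≤ d) {N : Fin n → ℝ} (hN0 : ∀ k, 0 ≤ N k) (hN : ∑ k, N k = 1) :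
    nrm ι F ≤ (1 + κ) * nrm ι (copies d fun k t => N k ^ θ * F t) +
      n * ((κ + 2 * η ^ θ) * nrm ι F) := by
  have hd0 : 0 ≤ d := hF.pos.le.trans hd
  have hN1 : ∀ k, N k ≤ 1 := fun k => hN ▸ Finset.single_le_sum (fun j _ => hN0 j)
    (Finset.mem_univ k)
  obtain ⟨hr, hrn⟩ := hF.nrm_remainder hι (x := 2 * η ^ θ) (by positivity) hF.A_nonneg hF.A_small
  have h := hι.nrm_copies_le hd0 (h := fun k t => N k ^ θ * F t)
    (g := fun k t => F (t / N k)) (C := 1 + κ)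
    (fun k => hF.bddSupp.dilate (hF.of_nonpos 0 le_rfl) (hN0 k))
    (fun k => hF.bddSupp.const_mul _) hr (by linarith)
    (fun k t => hF.nonneg _) fun k t => ?_
  · rw [hι.nrm_copies_dilate hF.bddSupp hF.of_nonpos (fun t ht => hF.of_le t (hd.trans ht)) hd0
      hN0 hN] at h
    exact h.trans (add_le_add le_rfl (mul_le_mul_of_nonneg_left hrn (by positivity)))
  · have h2 := hF.nonneg t
    have h6 : 0 ≤ η ^ θ * F t := by positivity
    have h4 : 0 ≤ A * chi a t := mul_nonneg hF.A_nonneg (chi_nonneg _ _)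
    have h7 : 0 ≤ (1 + κ) * (N k ^ θ * F t) :=
      mul_nonneg (by linarith) (mul_nonneg (Real.rpow_nonneg (hN0 k) _) h2)
    rcases le_or_gt η (N k) with hk | hk
    · have h1 := hF.dilate_le (N k) t hk (hN1 k)
      linarith
    -- For `N k < η`, monotonicity of `F` reduces to dilation by `η` itself, which is at most `2 * η
    -- ^ θ * F` plus the cut-off error.
    · have h8 : F (t / N k) ≤ F (t / η) := by
        rcases le_or_gt t 0 with ht | ht
        · rw [hF.of_nonpos (t / N k) (div_nonpos_of_nonpos_of_nonneg ht (hN0 k))]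
          exact hF.nonneg _
        rcases (hN0 k).eq_or_lt with h0 | h0
        · rw [← h0, div_zero, hF.of_nonpos 0 le_rfl]; exact hF.nonneg _
        · exact hF.anti _ _ (div_pos ht hη) (div_le_div_of_nonneg_left ht.le h0 hk.le)
      have h1 := hF.dilate_le η t le_rfl hη1
      have h9 : (1 + κ) * η ^ θ * F t ≤ 2 * η ^ θ * F t := by
        rw [mul_assoc, mul_assoc]; exact mul_le_mul_of_nonneg_right (by linarith) h6
      linarith

/-- The case `p = ∞`: for `θ = 0` dilations hardly change `F`, so each copy is compared with the
dilation by `1 / n`, and `n` of these are together equimeasurable with `F`. -/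
lemma AlmostHomogeneous.nrm_copies_const_le (hF : AlmostHomogeneous ι 0 η κ F a b A B)
    (hι : IsRISpace ι) (hκ : 0 ≤ κ) {n : ℕ} (hn : 0 < n) (hηn : η ≤ (n : ℝ)⁻¹)
    {d : ℝ} (hd : b ≤ d) {c : Fin n → ℝ} (hc0 : ∀ k, 0 ≤ c k) (hc1 : ∀ k, c k ≤ 1) :
    nrm ι (copies d fun k t => c k * F t) ≤ (1 + κ) * nrm ι F + n * (κ * nrm ι F) := by
  have hd0 : 0 ≤ d := hF.pos.le.trans hd
  have hn0 : (0 : ℝ) < n := by exact_mod_cast hn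
  have hN0 : 0 ≤ (n : ℝ)⁻¹ := by positivity
  have hN1 : (n : ℝ)⁻¹ ≤ 1 := inv_le_one_of_one_le₀ (by exact_mod_cast hn)
  have h := hι.nrm_copies_le hd0 (g := fun k t => c k * F t)
    (h := fun (k : Fin n) t => F (t / (n : ℝ)⁻¹)) (C := 1 + κ) (fun k => hF.bddSupp.const_mul _)
    (fun k => hF.bddSupp.dilate (hF.of_nonpos 0 le_rfl) hN0) ((BddSupp.chi b).const_mul B)
    (by linarith) (fun k t => mul_nonneg (hc0 k) (hF.nonneg t)) fun k t => ?_
  · rw [hι.nrm_copies_dilate (N := fun _ => (n : ℝ)⁻¹) hF.bddSupp hF.of_nonpos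
      (fun t ht => hF.of_le t (hd.trans ht)) hd0 (fun _ => hN0) (by simp [hn0.ne']),
      hι.nrm_const_mul (.chi b), abs_of_nonneg hF.B_nonneg] at h
    exact h.trans (add_le_add le_rfl (mul_le_mul_of_nonneg_left hF.B_small hn0.le))
  · have h1 := hF.le_dilate _ t hηn hN1
    rw [Real.rpow_zero, one_mul] at h1
    exact (mul_le_of_le_one_left (hF.nonneg t) (hc1 k)).trans h1

lemma IsRISpace.le_nrm_copies_const (hι : IsRISpace ι) (hF : BddSupp F) (hF0 : ∀ t, 0 ≤ F t)
    {n : ℕ} {d : ℝ} (hd : 0 ≤ d) {c : Fin n → ℝ} (hc0 : ∀ k, 0 ≤ c k) {j : Fin n}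
    (hj : c j = 1) : nrm ι F ≤ nrm ι (copies d fun k t => c k * F t) := by
  rw [← hι.nrm_shift hF (d := j * d) (by positivity)]
  refine hι.nrm_mono_of_nonneg (hF.shift (by positivity))
    (.copies hd fun k => hF.const_mul _) (fun t => hF0 _) fun t _ => ?_
  have := Finset.single_le_sum (f := fun k => c k * F (t - k * d))
    (fun k _ => mul_nonneg (hc0 k) (hF0 _)) (Finset.mem_univ j)
  simp only [hj, one_mul] at this
  exact this

end

section

variable {E : Type*} [NormedAddCommGroup E] [NormedSpace ℝ E] {ι : E →ₗ[ℝ] S}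
  {θ η κ : ℝ} {F : ℝ → ℝ} {a b A B : ℝ}

/-- For nonnegative coefficients, the copies of `F` behave like the basis of `ℓ^p_n`
up to the factor `1 + ε`. -/
def CopiesLikeLp (ι : E →ₗ[ℝ] S) (p : ENNReal) (n : ℕ) (d ε : ℝ) (F : ℝ → ℝ) (W : ℝ) : Prop :=
  ∀ c : Fin n → ℝ, (∀ k, 0 ≤ c k) → ‖WithLp.toLp p c‖ = 1 →
    nrm ι (copies d fun k t => c k * F t) ≤ (1 + ε) * W ∧
    W ≤ (1 + ε) * nrm ι (copies d fun k t => c k * F t)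

/-- For finite `p` the choice `N k = c k ^ p` gives `∑ N k = 1` and `N k ^ θ = c k`. For `p = ∞` the
upper bound uses equal dilations, and the lower bound a single coefficient equal to `1`. -/
lemma IsRISpace.exists_copiesLikeLp (hι : IsRISpace ι) {p : ENNReal} [Fact (1 ≤ p)]
    (h : DecaysBothSides (fun t => nrm ι (chi t)) (p⁻¹).toReal) (n : ℕ) {ε : ℝ} (hε : 0 < ε)
    (hε1 : ε ≤ 1) :
    ∃ η κ F a b A B, AlmostHomogeneous ι (p⁻¹).toReal η κ F a b A B ∧
      ∀ d, b ≤ d → CopiesLikeLp ι p n d ε F (nrm ι F) := by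
  set κ : ℝ := ε / (16 * (n + 1)) with hκ
  have hκ0 : 0 < κ := by positivity
  have hκn : (n + 1) * κ = ε / 16 := by rw [hκ]; field_simp
  have hnκ : n * κ ≤ ε / 16 := by nlinarith
  have hκε : κ ≤ ε / 16 := by
    have : 0 ≤ n * κ := by positivity
    linarith
  have hκ1 : κ ≤ 1 := by linarith
  rcases eq_or_ne p ⊤ with rfl | hp
  · rw [ENNReal.inv_top, ENNReal.toReal_zero] at h ⊢
    -- Any positive `η ≤ 1 / n` would do; `n + 1` also makes sense for `n = 0`.
    have hη : (0 : ℝ) < (n + 1 : ℝ)⁻¹ := by positivity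
    obtain ⟨F, a, b, A, B, hF⟩ := hι.exists_almostHomogeneous le_rfl h hη
      (inv_le_one_of_one_le₀ (by linarith [n.cast_nonneg (α := ℝ)])) hκ0 hκ1
    have hW := hF.nrm_pos
    refine ⟨_, _, F, a, b, A, B, hF, fun d hd c hc0 hc => ?_⟩
    have hn : 0 < n := by
      rcases Nat.eq_zero_or_pos n with rfl | hn
      · simp [PiLp.norm_eq_ciSup] at hc
      · exact hn
    have : Nonempty (Fin n) := ⟨⟨0, hn⟩⟩
    have hc1 : ∀ k, c k ≤ 1 := fun k => by
      have := PiLp.norm_apply_le (WithLp.toLp ⊤ c) k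
      rw [hc] at this
      exact (Real.le_norm_self _).trans this
    obtain ⟨j, hj⟩ : ∃ j, c j = 1 := by
      obtain ⟨j, hj⟩ := exists_eq_ciSup_of_finite (f := fun k => ‖(WithLp.toLp ⊤ c) k‖)
      refine ⟨j, ?_⟩
      rw [PiLp.norm_eq_ciSup, ← hj] at hc
      simpa [abs_of_nonneg (hc0 j)] using hc
    have h1 := hF.nrm_copies_const_le hι hκ0.le hn
      (inv_anti₀ (by exact_mod_cast hn) (by linarith)) hd hc0 hc1
    have h2 := hι.le_nrm_copies_const hF.bddSupp hF.nonneg (hF.pos.le.trans hd) hc0 hj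
    have h3 := nrm_nonneg (ι := ι) (copies d fun k t => c k * F t)
    constructor
    · nlinarith
    · nlinarith
  · have hp0 : 0 < p.toReal :=
      ENNReal.toReal_pos (zero_lt_one.trans_le (Fact.out : 1 ≤ p)).ne' hp
    rw [ENNReal.toReal_inv] at h ⊢
    -- With `η = κ ^ p` the contribution `η ^ θ` of the small coefficients is exactly `κ`.
    have hη : 0 < κ ^ p.toReal := by positivity
    have hη1 : κ ^ p.toReal ≤ 1 := Real.rpow_le_one hκ0.le hκ1 hp0.le
    obtain ⟨F, a, b, A, B, hF⟩ := hι.exists_almostHomogeneous (by positivity) h hη hη1 hκ0 hκ1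
    have hW := hF.nrm_pos
    refine ⟨_, _, F, a, b, A, B, hF, fun d hd c hc0 hc => ?_⟩
    have hs0 : 0 ≤ ∑ k, c k ^ p.toReal :=
      Finset.sum_nonneg fun k _ => Real.rpow_nonneg (hc0 k) _
    have hs : ∑ k, c k ^ p.toReal = 1 := by
      rw [PiLp.norm_eq_sum hp0] at hc
      simp only [Real.norm_eq_abs, abs_of_nonneg (hc0 _)] at hc
      rw [← Real.rpow_inv_rpow hs0 hp0.ne', ← one_div, hc, Real.one_rpow]
    have hck : ∀ k, (c k ^ p.toReal) ^ p.toReal⁻¹ = c k := fun k =>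
      Real.rpow_rpow_inv (hc0 k) hp0.ne'
    have h1 := hF.nrm_copies_rpow_le hι hη hκ0.le (by positivity) hd
      (fun k => Real.rpow_nonneg (hc0 k) p.toReal) hs
    have h2 := hF.le_nrm_copies_rpow hι hη hη1 hκ0.le hκ1 hd
      (fun k => Real.rpow_nonneg (hc0 k) p.toReal) hs
    simp only [hck, Real.rpow_rpow_inv hκ0.le hp0.ne'] at h1 h2
    have h3 := nrm_nonneg (ι := ι) (copies d fun k t => c k * F t)
    set X := nrm ι (copies d fun k t => c k * F t)
    set W := nrm ι F
    have h4 : n * κ * W ≤ ε / 16 * W := mul_le_mul_of_nonneg_right hnκ hW.le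
    have h5 : κ * W ≤ ε / 16 * W := mul_le_mul_of_nonneg_right hκε hW.le
    have h6 : κ * X ≤ ε / 16 * X := mul_le_mul_of_nonneg_right hκε h3
    constructor
    · have h1' : X ≤ W + κ * W + 2 * (n * κ * W) := by linarith
      nlinarith
    · have h2' : W ≤ X + κ * X + 3 * (n * κ * W) := by linarith
      have h7 : (1 - 3 * ε / 16) * W ≤ (1 + ε / 16) * X := by linarith
      have h8 : (1 + ε / 16) ≤ (1 - 3 * ε / 16) * (1 + ε) := by nlinarith
      have h9 := mul_le_mul_of_nonneg_right h8 h3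
      have h10 : (0 : ℝ) < 1 - 3 * ε / 16 := by linarith
      refine le_of_mul_le_mul_left ?_ h10
      linarith

/-! ### Approximation by dyadic step functions, and arbitrary signs. -/

/-- `f` is almost everywhere a linear combination of characteristic functions of dyadic intervals
of length `2 ^ (-l)`. -/
def DyadicStep (l K : ℕ) (v : ℕ → ℝ) (f : ℝ → ℝ) : Prop :=
  ∀ t, t ≠ 0 → f t = ∑ j ∈ Finset.range K,
    v j * (Set.Ico ((j : ℝ) / 2 ^ l) (((j : ℝ) + 1) / 2 ^ l)).indicator (fun _ => (1 : ℝ)) t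

/-- The value of `F` at the right end of the dyadic interval of length `2 ^ (-l)`. -/
def dyadicApprox (F : ℝ → ℝ) (l : ℕ) (t : ℝ) : ℝ :=
  if 0 < t then F (((⌊2 ^ l * t⌋₊ : ℝ) + 1) / 2 ^ l) else 0

lemma mem_dyadic_iff {l j : ℕ} {t : ℝ} (ht : 0 ≤ t) :
    t ∈ Set.Ico ((j : ℝ) / 2 ^ l) (((j : ℝ) + 1) / 2 ^ l) ↔ ⌊2 ^ l * t⌋₊ = j := by
  have h2 : (0 : ℝ) < 2 ^ l := by positivity
  rw [Nat.floor_eq_iff (by positivity), Set.mem_Ico, div_le_iff₀ h2, lt_div_iff₀ h2, mul_comm t]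

lemma AlmostHomogeneous.dyadicStep (hF : AlmostHomogeneous ι θ η κ F a b A B) (l : ℕ) {D : ℕ}
    (hD : b ≤ D) :
    DyadicStep l (D * 2 ^ l) (fun j => F (((j : ℝ) + 1) / 2 ^ l)) (dyadicApprox F l) := by
  intro t ht
  have h2 : (0 : ℝ) < 2 ^ l := by positivity
  unfold dyadicApprox
  split_ifs with h
  · rw [Finset.sum_eq_single ⌊2 ^ l * t⌋₊]
    · rw [Set.indicator_of_mem ((mem_dyadic_iff h.le).2 rfl), mul_one]
    · intro j _ hj
      rw [Set.indicator_of_notMem fun hm => hj ((mem_dyadic_iff h.le).1 hm).symm, mul_zero]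
    · intro hn
      refine mul_eq_zero_of_left (hF.of_le _ ?_) _
      rw [Finset.mem_range, not_lt] at hn
      have hn' : (D : ℝ) * 2 ^ l ≤ (⌊2 ^ l * t⌋₊ : ℝ) := by exact_mod_cast hn
      rw [le_div_iff₀ h2]
      nlinarith [mul_le_mul_of_nonneg_right hD h2.le]
  -- The point `t = 0` has to be excluded: it lies in the first dyadic interval, whereas the
  -- approximation vanishes there.
  · have h' : t < 0 := lt_of_le_of_ne (not_lt.1 h) ht
    symm
    refine Finset.sum_eq_zero fun j _ => ?_
    rw [Set.indicator_of_notMem, mul_zero]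
    intro hm
    have : (0 : ℝ) ≤ (j : ℝ) / 2 ^ l := by positivity
    linarith [hm.1]

lemma AlmostHomogeneous.dyadicApprox_nonneg (hF : AlmostHomogeneous ι θ η κ F a b A B) (l : ℕ)
    (t : ℝ) : 0 ≤ dyadicApprox F l t := by
  unfold dyadicApprox
  split_ifs
  · exact hF.nonneg _
  · rfl

lemma lt_dyadic_right (l : ℕ) (t : ℝ) : t < ((⌊2 ^ l * t⌋₊ : ℝ) + 1) / 2 ^ l := by
  rw [lt_div_iff₀ (by positivity), mul_comm]
  exact Nat.lt_floor_add_one _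

lemma AlmostHomogeneous.dyadicApprox_le (hF : AlmostHomogeneous ι θ η κ F a b A B) (l : ℕ)
    (t : ℝ) : dyadicApprox F l t ≤ F t := by
  unfold dyadicApprox
  split_ifs with h
  · exact hF.anti _ _ h (lt_dyadic_right l t).le
  · exact hF.nonneg t

/-- Moving to the right end of a dyadic interval changes the Lipschitz function `F` by at most `L /
2 ^ l`, and both functions vanish beyond `b`. -/
lemma AlmostHomogeneous.exists_le_dyadicApprox (hF : AlmostHomogeneous ι θ η κ F a b A B)
    {ρ : ℝ} (hρ : 0 < ρ) : ∃ l, ∀ t, F t ≤ dyadicApprox F l t + ρ * chi b t := by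
  obtain ⟨L, hL0, hL⟩ := hF.lipschitz
  obtain ⟨l, hl⟩ := pow_unbounded_of_one_lt (L / ρ) one_lt_two
  refine ⟨l, fun t => ?_⟩
  have h2 : (0 : ℝ) < 2 ^ l := by positivity
  rcases le_or_gt t 0 with ht | ht
  · rw [hF.of_nonpos t ht]
    exact add_nonneg (hF.dyadicApprox_nonneg l t) (mul_nonneg hρ.le (chi_nonneg _ _))
  rcases le_or_gt b t with htb | htb
  · rw [hF.of_le t htb]
    exact add_nonneg (hF.dyadicApprox_nonneg l t) (mul_nonneg hρ.le (chi_nonneg _ _))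
  rw [chi_of_mem ht htb, mul_one, dyadicApprox, if_pos ht]
  have h1 := hL t _ ht (lt_dyadic_right l t).le
  have h3 : ((⌊2 ^ l * t⌋₊ : ℝ) + 1) / 2 ^ l - t ≤ 1 / 2 ^ l := by
    have h5 : (⌊2 ^ l * t⌋₊ : ℝ) / 2 ^ l ≤ t := by
      rw [div_le_iff₀ h2, mul_comm t]
      exact Nat.floor_le (by positivity)
    rw [add_div]
    linarith
  have h4 : L * (1 / 2 ^ l) ≤ ρ := by
    rw [div_lt_iff₀ hρ] at hl
    rw [mul_one_div, div_le_iff₀ h2]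
    linarith
  have := mul_le_mul_of_nonneg_left h3 hL0
  linarith

lemma bddSupp_dyadicApprox (hF : AlmostHomogeneous ι θ η κ F a b A B) (l : ℕ) :
    BddSupp (dyadicApprox F l) := by
  obtain ⟨C, hC⟩ := hF.bddSupp.bdd
  refine ⟨?_, fun t ht => if_neg ht.not_gt, ⟨C, fun t => ?_⟩, ⟨b, fun t ht => ?_⟩⟩
  · unfold dyadicApprox
    refine Measurable.ite measurableSet_Ioi (hF.bddSupp.meas.comp ?_) measurable_const
    refine Measurable.div_const (Measurable.add_const ?_ _) _
    exact measurable_from_nat.comp (Nat.measurable_floor.comp (measurable_const_mul _))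
  · rw [abs_of_nonneg (hF.dyadicApprox_nonneg l t)]
    exact (hF.dyadicApprox_le l t).trans ((le_abs_self _).trans (hC t))
  · exact le_antisymm ((hF.dyadicApprox_le l t).trans_eq (hF.of_le t ht))
      (hF.dyadicApprox_nonneg l t)

/-- As coefficients of a unit vector are at most `1`, the error over `n` copies is at most `ε / 8 *
W`. Tripling `ε` absorbs it, by `1 + ε ≤ (1 - ε/4) * (1 + 3ε)` for `ε ≤ 1`. -/
lemma IsRISpace.copiesLikeLp_approx (hι : IsRISpace ι) {p : ENNReal} [Fact (1 ≤ p)] {n : ℕ}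
    {d ε W y ρ : ℝ} {f : ℝ → ℝ} (hε : 0 < ε) (hε1 : ε ≤ 1) (hd : 0 ≤ d)
    (hFl : CopiesLikeLp ι p n d ε F W) (hW : 0 ≤ W) (hF : BddSupp F) (hf : BddSupp f)
    (hf0 : ∀ t, 0 ≤ f t) (hfF : ∀ t, f t ≤ F t) (hρ : 0 ≤ ρ)
    (hFf : ∀ t, F t ≤ f t + ρ * chi y t) (hn : n * (ρ * nrm ι (chi y)) ≤ ε / 8 * W) :
    CopiesLikeLp ι p n d (3 * ε) f W := by
  intro c hc0 hc
  obtain ⟨h1, h2⟩ := hFl c hc0 hc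
  have hc1 : ∀ k, c k ≤ 1 := fun k => by
    have := PiLp.norm_apply_le (WithLp.toLp p c) k
    rw [hc] at this
    exact (Real.le_norm_self _).trans this
  have h3 : nrm ι (copies d fun k t => c k * f t) ≤ nrm ι (copies d fun k t => c k * F t) :=
    hι.nrm_mono_of_nonneg (.copies hd fun k => hf.const_mul _) (.copies hd fun k => hF.const_mul _)
      (fun t => Finset.sum_nonneg fun k _ => mul_nonneg (hc0 k) (hf0 _))
      fun t _ => Finset.sum_le_sum fun k _ => mul_le_mul_of_nonneg_left (hfF _) (hc0 k)
  have h4 := hι.nrm_copies_le hd (g := fun k t => c k * F t) (h := fun k t => c k * f t)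
    (fun k => hF.const_mul _) (fun k => hf.const_mul _) ((BddSupp.chi y).const_mul ρ) zero_le_one
    (fun k t => mul_nonneg (hc0 k) ((hf0 t).trans (hfF t))) fun k t => by
      have := mul_le_mul_of_nonneg_left (hFf t) (hc0 k)
      have h5 : 0 ≤ ρ * chi y t := mul_nonneg hρ (chi_nonneg _ _)
      have := mul_le_of_le_one_left h5 (hc1 k)
      linarith
  rw [hι.nrm_const_mul (.chi y), abs_of_nonneg hρ, one_mul] at h4
  have h5 := nrm_nonneg (ι := ι) (copies d fun k t => c k * f t)
  set X := nrm ι (copies d fun k t => c k * f t)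
  set Y := nrm ι (copies d fun k t => c k * F t)
  constructor
  · nlinarith
  · have h6 : W ≤ (1 + ε) * (X + ε / 8 * W) :=
      h2.trans (mul_le_mul_of_nonneg_left (by linarith) (by linarith))
    have h7 : (1 + ε) * (ε / 8 * W) ≤ ε / 4 * W := by nlinarith [mul_nonneg hε.le hW]
    have h8 : (1 - ε / 4) * W ≤ (1 + ε) * X := by linarith
    have h9 : 1 + ε ≤ (1 - ε / 4) * (1 + 3 * ε) := by nlinarith
    have h10 := mul_le_mul_of_nonneg_right h9 h5
    refine le_of_mul_le_mul_left ?_ (show 0 < 1 - ε / 4 by linarith)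
    linarith

/-- Disjointness makes the absolute value of a combination depend only on the `|c k|`; homogeneity
then removes the normalization. -/
lemma CopiesLikeLp.of_signs (hι : IsRISpace ι) {p : ENNReal} [Fact (1 ≤ p)] {n : ℕ}
    {d ε W : ℝ} {f : ℝ → ℝ} (hfl : CopiesLikeLp ι p n d ε f W) (hd : 0 ≤ d) (hf : BddSupp f)
    (hf0 : ∀ t, 0 ≤ f t) (hfd : ∀ t, f t ≠ 0 → 0 ≤ t ∧ t < d) (c : Fin n → ℝ) :
    nrm ι (copies d fun k t => c k * f t) ≤ (1 + ε) * W * ‖WithLp.toLp p c‖ ∧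
    W * ‖WithLp.toLp p c‖ ≤ (1 + ε) * nrm ι (copies d fun k t => c k * f t) := by
  have hb : ∀ c : Fin n → ℝ, BddSupp (copies d fun k t => c k * f t) := fun c =>
    .copies hd fun k => hf.const_mul _
  rcases eq_or_ne (‖WithLp.toLp p c‖) 0 with h0 | h0
  · have hc : ∀ k, c k = 0 := fun k => by
      have := PiLp.norm_apply_le (WithLp.toLp p c) k
      rw [h0] at this
      exact norm_le_zero_iff.1 this
    have h1 : nrm ι (copies d fun k t => c k * f t) = 0 := by
      have h := hι.nrm_const_mul (hb c) 0
      rw [abs_zero, zero_mul] at h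
      rw [← h]
      congr 1
      funext t
      simp [copies, hc]
    rw [h0, h1]; simp
  set A := ‖WithLp.toLp p c‖ with hA
  have hA0 : 0 < A := lt_of_le_of_ne (norm_nonneg _) (Ne.symm h0)
  have hn : ‖WithLp.toLp p fun k => A⁻¹ * |c k|‖ = 1 := by
    have h1 : (WithLp.toLp p fun k => A⁻¹ * |c k|) = A⁻¹ • WithLp.toLp p fun k => |c k| := by
      ext k; simp
    have h2 : ‖WithLp.toLp p fun k => |c k|‖ = A := by
      rw [hA]
      rcases eq_or_ne p ⊤ with rfl | hp
      · simp [PiLp.norm_eq_ciSup]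
      · have hp0 : 0 < p.toReal :=
          ENNReal.toReal_pos (zero_lt_one.trans_le (Fact.out : 1 ≤ p)).ne' hp
        simp [PiLp.norm_eq_sum hp0]
    rw [h1, norm_smul, h2, norm_inv, Real.norm_eq_abs, abs_of_pos hA0, inv_mul_cancel₀ h0]
  obtain ⟨h1, h2⟩ := hfl _ (fun k => by positivity) hn
  have h3 : nrm ι (copies d fun k t => c k * f t) =
      A * nrm ι (copies d fun k t => A⁻¹ * |c k| * f t) := by
    have h4 := hι.nrm_const_mul (hb fun k => A⁻¹ * |c k|) A
    rw [abs_of_pos hA0] at h4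
    have key : ∀ t, |copies d (fun k t => c k * f t) t| =
        |A * copies d (fun k t => A⁻¹ * |c k| * f t) t| := fun t => by
      have h5 : A * copies d (fun k t => A⁻¹ * |c k| * f t) t =
          |copies d (fun k t => c k * f t) t| := by
        rw [abs_copies hd fun k t ht => hfd t (right_ne_zero_of_mul ht), copies, copies,
          Finset.mul_sum]
        refine Finset.sum_congr rfl fun k _ => ?_
        rw [abs_mul, abs_of_nonneg (hf0 _)]
        field_simp
      rw [h5, abs_abs]
    rw [← h4]
    exact le_antisymm (hι.nrm_mono (hb c) ((hb _).const_mul A) fun t _ => (key t).le)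
      (hι.nrm_mono ((hb _).const_mul A) (hb c) fun t _ => (key t).ge)
  rw [h3]
  constructor
  · calc _ ≤ A * ((1 + ε) * W) := mul_le_mul_of_nonneg_left h1 hA0.le
      _ = _ := by ring
  · calc W * A ≤ (1 + ε) * nrm ι (copies d fun k t => A⁻¹ * |c k| * f t) * A :=
        mul_le_mul_of_nonneg_right h2 hA0.le
      _ = _ := by ring

/-- There is a dyadic step function whose translates span `ℓ^p_n` almost isometrically. -/
lemma IsRISpace.exists_dyadicStep (hι : IsRISpace ι) {p : ENNReal} [Fact (1 ≤ p)]
    (h : DecaysBothSides (fun t => nrm ι (chi t)) (p⁻¹).toReal) (n : ℕ) {ε : ℝ} (hε : 0 < ε) :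
    ∃ (l K D : ℕ) (v : ℕ → ℝ) (f : ℝ → ℝ) (W : ℝ), BddSupp f ∧ DyadicStep l K v f ∧
      (∀ t, f t ≠ 0 → 0 ≤ t ∧ t < D) ∧ 0 < W ∧ ∀ c : Fin n → ℝ,
        nrm ι (copies D fun k t => c k * f t) ≤ (1 + ε) * W * ‖WithLp.toLp p c‖ ∧
        W * ‖WithLp.toLp p c‖ ≤ (1 + ε) * nrm ι (copies D fun k t => c k * f t) := by
  set δ := min 1 ε / 3 with hδ
  have hm : 0 < min 1 ε := lt_min one_pos hε
  have hδ0 : 0 < δ := by positivity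
  have hδ1 : 3 * δ ≤ 1 := by rw [hδ]; linarith [min_le_left 1 ε]
  have hδε : 3 * δ ≤ ε := by rw [hδ]; linarith [min_le_right 1 ε]
  obtain ⟨η, κ, F, a, b, A, B, hF, hFl⟩ :=
    hι.exists_copiesLikeLp h n hδ0 (show δ ≤ 1 by linarith)
  have hW := hF.nrm_pos
  have hφ := hι.nrm_chi_pos hF.pos
  obtain ⟨l, hl⟩ := hF.exists_le_dyadicApprox
    (ρ := δ / 8 * nrm ι F / ((n + 1) * nrm ι (chi b))) (by positivity)
  -- The translation step is an integer, so translates of a dyadic step function remain dyadic at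
  -- the same level.
  have hD : b ≤ (⌈b⌉₊ : ℝ) := Nat.le_ceil b
  have hD0 : (0 : ℝ) ≤ (⌈b⌉₊ : ℝ) := Nat.cast_nonneg _
  have hfd : ∀ t, dyadicApprox F l t ≠ 0 → 0 ≤ t ∧ t < (⌈b⌉₊ : ℝ) := fun t ht => by
    have h1 : F t ≠ 0 := fun h0 => ht (le_antisymm ((hF.dyadicApprox_le l t).trans_eq h0)
      (hF.dyadicApprox_nonneg l t))
    refine ⟨?_, ?_⟩
    · by_contra hc; exact h1 (hF.of_nonpos t (not_le.1 hc).le)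
    · by_contra hc; exact h1 (hF.of_le t (hD.trans (not_lt.1 hc)))
  have hf := bddSupp_dyadicApprox hF l
  have hl2 : CopiesLikeLp ι p n (⌈b⌉₊ : ℝ) (3 * δ) (dyadicApprox F l) (nrm ι F) := by
    refine hι.copiesLikeLp_approx hδ0 (by linarith) hD0 (hFl _ hD) hW.le hF.bddSupp hf
      (hF.dyadicApprox_nonneg l) (hF.dyadicApprox_le l) (by positivity) hl ?_
    have : (n : ℝ) * (δ / 8 * nrm ι F / ((n + 1) * nrm ι (chi b)) * nrm ι (chi b)) =
        n / (n + 1) * (δ / 8 * nrm ι F) := by field_simp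
    rw [this]
    exact mul_le_of_le_one_left (by positivity) ((div_le_one (by positivity)).2 (by linarith))
  refine ⟨l, _, ⌈b⌉₊, _, dyadicApprox F l, nrm ι F, hf, hF.dyadicStep l hD, hfd, hW, fun c => ?_⟩
  obtain ⟨h1, h2⟩ := hl2.of_signs hι hD0 hf (hF.dyadicApprox_nonneg l) hfd c
  have h3 := nrm_nonneg (ι := ι) (copies ⌈b⌉₊ fun k t => c k * dyadicApprox F l t)
  constructor
  · refine h1.trans ?_
    gcongr
  · refine h2.trans ?_
    gcongr

end

/-! ### Dyadic step functions as successive blocks of an enumeration. -/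

lemma coeFn_charFn (A : Set ℝ) (hA : MeasurableSet A) :
    charFn A hA =ᵐ[mPos] A.indicator fun _ => (1 : ℝ) := AEEqFun.coeFn_mk _ _

lemma dyadicChar_eq_add (l j : ℕ) :
    dyadicChar l j = dyadicChar (l + 1) (2 * j) + dyadicChar (l + 1) (2 * j + 1) := by
  apply AEEqFun.ext
  filter_upwards [coeFn_charFn _ measurableSet_Ico, coeFn_charFn _ measurableSet_Ico,
    coeFn_charFn _ measurableSet_Ico, AEEqFun.coeFn_add (dyadicChar (l + 1) (2 * j))
    (dyadicChar (l + 1) (2 * j + 1))] with t h1 h2 h3 h4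
  rw [h4, Pi.add_apply]
  unfold dyadicChar
  rw [h1, h2, h3]
  have e1 : ((2 * j : ℕ) : ℝ) / 2 ^ (l + 1) = j / 2 ^ l := by
    push_cast; rw [pow_succ]; field_simp
  have e2 : (((2 * j : ℕ) : ℝ) + 1) / 2 ^ (l + 1) = ((2 * j + 1 : ℕ) : ℝ) / 2 ^ (l + 1) := by
    push_cast; ring
  have e3 : (((2 * j + 1 : ℕ) : ℝ) + 1) / 2 ^ (l + 1) = ((j : ℝ) + 1) / 2 ^ l := by
    push_cast; rw [pow_succ]; field_simp; ring
  have l1 : (j : ℝ) / 2 ^ l ≤ ((2 * j + 1 : ℕ) : ℝ) / 2 ^ (l + 1) := by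
    rw [← e1]; gcongr; omega
  have l2 : ((2 * j + 1 : ℕ) : ℝ) / 2 ^ (l + 1) ≤ ((j : ℝ) + 1) / 2 ^ l := by
    rw [← e3]; gcongr; linarith
  rw [e1, e2, e3, ← Set.Ico_union_Ico_eq_Ico l1 l2,
    Set.indicator_union_of_disjoint (Set.Ico_disjoint_Ico_same)]

lemma sum_dyadicChar_refine (l K : ℕ) (v : ℕ → ℝ) :
    ∑ j ∈ Finset.range K, v j • dyadicChar l j =
      ∑ j ∈ Finset.range (2 * K), v (j / 2) • dyadicChar (l + 1) j := by
  induction K with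
  | zero => simp
  | succ K ih =>
    rw [Finset.sum_range_succ, ih, show 2 * (K + 1) = 2 * K + 1 + 1 by ring,
      Finset.sum_range_succ, Finset.sum_range_succ, dyadicChar_eq_add, smul_add,
      show 2 * K / 2 = K by omega, show (2 * K + 1) / 2 = K by omega, add_assoc]

lemma exists_sum_dyadicChar_of_le {l L : ℕ} (h : l ≤ L) (K : ℕ) (v : ℕ → ℝ) :
    ∃ (K' : ℕ) (v' : ℕ → ℝ), ∑ j ∈ Finset.range K, v j • dyadicChar l j =
      ∑ j ∈ Finset.range K', v' j • dyadicChar L j := by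
  induction L, h using Nat.le_induction with
  | base => exact ⟨K, v, rfl⟩
  | succ L _ ih =>
    obtain ⟨K', v', h'⟩ := ih
    exact ⟨_, _, h'.trans (sum_dyadicChar_refine L K' v')⟩

/-- A dyadic step function is a block arbitrarily far in any enumeration of the dyadic intervals. -/
lemma exists_block (e : ℕ ≃ ℕ × ℕ) (l K : ℕ) (v : ℕ → ℝ) (m : ℕ) :
    ∃ (m' : ℕ) (α : ℕ → ℝ), m < m' ∧ ∑ j ∈ Finset.range K, v j • dyadicChar l j =
      ∑ i ∈ Finset.Ico m m', α i • dyadicChar (e i).1 (e i).2 := by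
  -- `L` exceeds the level of each of the first `m` intervals, so every interval of level `L` occurs
  -- at a position at least `m`.
  set L := l + ∑ i ∈ Finset.range m, ((e i).1 + 1) with hL
  obtain ⟨K', v', h⟩ := exists_sum_dyadicChar_of_le (show l ≤ L by omega) K v
  set M := ∑ j ∈ Finset.range K', (e.symm (L, j) + 1) with hM
  refine ⟨m + 1 + M, fun i => if (e i).1 = L ∧ (e i).2 < K' then v' (e i).2 else 0, by omega,
    h.trans (Finset.sum_of_injOn (fun j => e.symm (L, j)) ?_ ?_ ?_ ?_)⟩
  · intro j _ k _ hjk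
    simpa using hjk
  · intro j hj
    simp only [Finset.coe_range, Set.mem_Iio, Finset.coe_Ico, Set.mem_Ico] at hj ⊢
    have h1 : e.symm (L, j) + 1 ≤ M :=
      Finset.single_le_sum (f := fun j => e.symm (L, j) + 1) (fun _ _ => Nat.zero_le _)
        (Finset.mem_range.2 hj)
    refine ⟨?_, by omega⟩
    by_contra! hlt
    have h2 : (e (e.symm (L, j))).1 + 1 ≤ ∑ i ∈ Finset.range m, ((e i).1 + 1) :=
      Finset.single_le_sum (f := fun i => (e i).1 + 1) (fun _ _ => Nat.zero_le _)
        (Finset.mem_range.2 hlt)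
    rw [Equiv.apply_symm_apply] at h2
    simp only at h2
    omega
  · intro i _ hi
    refine smul_eq_zero_of_left (if_neg ?_) _
    rintro ⟨h1, h2⟩
    refine hi ⟨(e i).2, by simpa using h2, ?_⟩
    simp only [← h1, Prod.mk.eta, Equiv.symm_apply_apply]
  · intro j hj
    simp [Finset.mem_range.1 hj]

/-- Each block is started where the previous one ends. The separate coefficient sequences are glued
into one by looking up the block that contains the index. -/
lemma exists_successive_blocks {z : ℕ → S} {g : ℕ → S}
    (h : ∀ k m, ∃ (m' : ℕ) (α : ℕ → ℝ), m < m' ∧ g k = ∑ i ∈ Finset.Ico m m', α i • z i) :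
    ∃ (M : ℕ → ℕ) (α : ℕ → ℝ), M 0 = 0 ∧ StrictMono M ∧
      ∀ k, g k = ∑ i ∈ Finset.Ico (M k) (M (k + 1)), α i • z i := by
  choose next coef hlt hsum using h
  let M : ℕ → ℕ := fun k => Nat.rec (motive := fun _ => ℕ) 0 (fun k m => next k m) k
  have hM : ∀ k, M (k + 1) = next k (M k) := fun k => rfl
  have hmono : StrictMono M := strictMono_nat_of_lt_succ fun k => by rw [hM]; exact hlt k (M k)
  -- Searching up to `i` is enough, since `M k ≥ k` by strict monotonicity.
  let idx : ℕ → ℕ := fun i => Nat.findGreatest (fun k => M k ≤ i) i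
  refine ⟨M, fun i => coef (idx i) (M (idx i)) i, rfl, hmono, fun k => ?_⟩
  rw [hsum k (M k), ← hM]
  refine Finset.sum_congr rfl fun i hi => ?_
  rw [Finset.mem_Ico] at hi
  have hk : idx i = k := by
    rw [Nat.findGreatest_eq_iff]
    refine ⟨(hmono.id_le k).trans hi.1, fun _ => hi.1, fun j hj _ hc => ?_⟩
    have := hmono.monotone (show k + 1 ≤ j from hj)
    omega
  simp only [hk]

section

variable {E : Type*} [NormedAddCommGroup E] [NormedSpace ℝ E] {ι : E →ₗ[ℝ] S}

lemma coeFn_sum_dyadicChar (l : ℕ) (s : Finset ℕ) (v : ℕ → ℝ) :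
    (∑ j ∈ s, v j • dyadicChar l j : S) =ᵐ[mPos] fun t => ∑ j ∈ s, v j *
      (Set.Ico ((j : ℝ) / 2 ^ l) (((j : ℝ) + 1) / 2 ^ l)).indicator (fun _ => (1 : ℝ)) t := by
  classical
  induction s using Finset.induction_on with
  | empty => simp only [Finset.sum_empty]; exact AEEqFun.coeFn_zero
  | insert a s ha ih =>
    simp only [Finset.sum_insert ha]
    filter_upwards [AEEqFun.coeFn_add (v a • dyadicChar l a) (∑ j ∈ s, v j • dyadicChar l j), ih,
      AEEqFun.coeFn_smul (v a) (dyadicChar l a), coeFn_charFn _ measurableSet_Ico]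
      with t h1 h2 h3 h4
    rw [h1, Pi.add_apply, h2, h3, Pi.smul_apply, smul_eq_mul, dyadicChar, h4]

lemma DyadicStep.ae_eq_shift {l K : ℕ} {v : ℕ → ℝ} {f : ℝ → ℝ} (hf : DyadicStep l K v f)
    (m : ℕ) : (∑ j ∈ Finset.range (m * 2 ^ l + K), (if m * 2 ^ l ≤ j then v (j - m * 2 ^ l) else 0)
      • dyadicChar l j : S) =ᵐ[mPos] fun t => f (t - m) := by
  have hne : ∀ᵐ t ∂mPos, t ≠ (m : ℝ) := compl_mem_ae_iff.2 (measure_singleton _)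
  filter_upwards [coeFn_sum_dyadicChar l (Finset.range (m * 2 ^ l + K))
    fun j => if m * 2 ^ l ≤ j then v (j - m * 2 ^ l) else 0, hne] with t ht hne
  rw [ht, hf _ (sub_ne_zero.2 hne), Finset.sum_range_add]
  rw [Finset.sum_eq_zero, zero_add]
  · refine Finset.sum_congr rfl fun j _ => ?_
    rw [if_pos (Nat.le_add_right _ _), Nat.add_sub_cancel_left]
    congr 1
    have h2 : (2 : ℝ) ^ l ≠ 0 := by positivity
    have e1 : (((m * 2 ^ l + j : ℕ) : ℝ)) / 2 ^ l = j / 2 ^ l + m := by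
      push_cast; field_simp; ring
    have e2 : (((m * 2 ^ l + j : ℕ) : ℝ) + 1) / 2 ^ l = (j + 1) / 2 ^ l + m := by
      push_cast; field_simp; ring
    rw [e1, e2]
    simp only [Set.indicator_apply, Set.mem_Ico, le_sub_iff_add_le, sub_lt_iff_lt_add]
  · intro j hj
    rw [if_neg (not_le.2 (Finset.mem_range.1 hj)), zero_mul]

lemma IsRISpace.symmetricallyBlockFinitelyRepresented (hι : IsRISpace ι) {p : ENNReal}
    [Fact (1 ≤ p)] (h : DecaysBothSides (fundamentalFunction ι) (p⁻¹).toReal) (e : ℕ ≃ ℕ × ℕ) :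
    SymmetricallyBlockFinitelyRepresented ι p (fun i => dyadicChar (e i).1 (e i).2) := by
  intro n ε hε
  rw [show fundamentalFunction ι = fun t => nrm ι (chi t) from
    funext hι.fundamentalFunction_eq] at h
  obtain ⟨l, K, D, v, f, W, hfb, hstep, hfd, hW, hmain⟩ := hι.exists_dyadicStep h n hε
  -- Division by `W` normalizes the translates, so that the two-sided estimate is against the `ℓ^p`
  -- norm itself.
  have hr : ∀ k : ℕ, ∃ u : E, ι u =ᵐ[mPos] fun t => W⁻¹ * f (t - k * D) := fun k =>
    hι.exists_repr ((hfb.shift (by positivity)).const_mul _)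
  choose u hu using hr
  have hblock : ∀ k m, ∃ (m' : ℕ) (α : ℕ → ℝ), m < m' ∧
      ι (u k) = ∑ i ∈ Finset.Ico m m', α i • dyadicChar (e i).1 (e i).2 := by
    intro k m
    obtain ⟨m', α, hm, hα⟩ := exists_block e l (k * D * 2 ^ l + K)
      (fun j => if k * D * 2 ^ l ≤ j then v (j - k * D * 2 ^ l) else 0) m
    refine ⟨m', fun i => W⁻¹ * α i, hm, ?_⟩
    have hs : ι (u k) = W⁻¹ • ∑ i ∈ Finset.Ico m m', α i • dyadicChar (e i).1 (e i).2 := by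
      rw [← hα]
      apply AEEqFun.ext
      filter_upwards [hu k, hstep.ae_eq_shift (k * D), AEEqFun.coeFn_smul W⁻¹
        (∑ j ∈ Finset.range (k * D * 2 ^ l + K),
          (if k * D * 2 ^ l ≤ j then v (j - k * D * 2 ^ l) else 0) • dyadicChar l j)]
        with t h1 h2 h3
      rw [h1, h3, Pi.smul_apply, h2, smul_eq_mul]
      push_cast
      rfl
    rw [hs, Finset.smul_sum]
    simp only [smul_smul]
  obtain ⟨M, α, hM0, hM, hg⟩ := exists_successive_blocks hblock
  refine ⟨fun k => M k, α, fun k => u k, by simpa using hM0, fun i j hij => hM hij, fun k => ?_,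
    fun j k hjk => ?_, fun j k τ hτ => ?_, fun a => ?_⟩
  · simpa using hg k
  · filter_upwards [hu j, hu k] with t h1 h2
    rw [h1, h2]
    by_contra! hc
    exact hjk (eq_of_shift_ne_zero (Nat.cast_nonneg D) hfd hfd (right_ne_zero_of_mul hc.1)
      (right_ne_zero_of_mul hc.2))
  · have hd : ∀ k : ℕ, distrib (ι (u k)) τ = dst (fun t => W⁻¹ * f t) τ := fun k => by
      rw [distrib_eq_dst (hu k)]
      exact dst_shift (hfb.const_mul W⁻¹).neg (by positivity) hτ.le
    rw [hd, hd]
  · have hrep : ι (∑ k : Fin n, a k • u k) =ᵐ[mPos]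
        fun t => W⁻¹ * copies D (fun k t => a k * f t) t := by
      refine (repr_sum Finset.univ fun (k : Fin n) _ => repr_smul (hu k) (a k)).trans
        (Eventually.of_forall fun t => ?_)
      simp only [copies, Finset.mul_sum]
      exact Finset.sum_congr rfl fun k _ => by ring
    rw [← hι.nrm_eq hrep, hι.nrm_const_mul (.copies (Nat.cast_nonneg D) fun k => hfb.const_mul _),
      abs_of_pos (inv_pos.2 hW)]
    obtain ⟨h1, h2⟩ := hmain a
    have hε0 : 0 < 1 + ε := by linarith
    constructor
    · rw [inv_mul_le_iff₀ hε0, mul_left_comm, le_inv_mul_iff₀ hW]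
      exact h2
    · rw [inv_mul_le_iff₀ hW]
      linarith

end

/-! ### Dilation indices of the fundamental function. -/

/-- Positive nondecreasing functions on `(0, ∞)` with `φ (2 ^ n * s) ≤ 2 ^ n * φ s`. -/
structure TameGrowth (φ : ℝ → ℝ) : Prop where
  pos : ∀ s, 0 < s → 0 < φ s
  mono : ∀ s t, 0 < s → s ≤ t → φ s ≤ φ t
  two_pow : ∀ (n : ℕ) s, 0 < s → φ (2 ^ n * s) ≤ 2 ^ n * φ s

/-- Fekete's lemma for the logarithms; the geometric lower bound keeps the quotients above `-1`, so
the limit is finite. -/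
lemma tendsto_logb_of_submultiplicative {m : ℕ → ℝ} (hpos : ∀ n, 0 < m n)
    (hsub : ∀ i j, m (i + j) ≤ m i * m j) (hlow : ∀ n, ((1 : ℝ) / 2) ^ n ≤ m n) :
    ∃ L, Tendsto (fun n : ℕ => 1 / (n : ℝ) * Real.logb 2 (m n)) atTop (𝓝 L) := by
  have hs : Subadditive fun n => Real.logb 2 (m n) := fun i j => by
    rw [← Real.logb_mul (hpos i).ne' (hpos j).ne']
    exact Real.logb_le_logb_of_le one_lt_two (hpos _) (hsub i j)
  have hb : BddBelow (Set.range fun n : ℕ => Real.logb 2 (m n) / n) := by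
    refine ⟨-1, ?_⟩
    rintro _ ⟨n, rfl⟩
    rcases Nat.eq_zero_or_pos n with rfl | hn
    · simp
    have hn' : (0 : ℝ) < n := by exact_mod_cast hn
    rw [le_div_iff₀ hn', Real.le_logb_iff_rpow_le one_lt_two (hpos n), neg_one_mul,
      Real.rpow_neg two_pos.le, Real.rpow_natCast]
    simpa using hlow n
  refine ⟨_, (hs.tendsto_lim hb).congr fun n => ?_⟩
  rw [div_mul_eq_mul_div, one_mul]

lemma index_le_of_le {m : ℕ → ℝ} {L C x : ℝ} (hpos : ∀ n, 0 < m n)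
    (hL : Tendsto (fun n : ℕ => 1 / (n : ℝ) * Real.logb 2 (m n)) atTop (𝓝 L)) (hC : 0 < C)
    (h : ∀ n, m n ≤ C * 2 ^ (n * x)) : L ≤ x := by
  have h1 : Tendsto (fun n : ℕ => Real.logb 2 C / (n : ℝ) + x) atTop (𝓝 (0 + x)) :=
    (tendsto_const_nhds.div_atTop tendsto_natCast_atTop_atTop).add_const x
  rw [zero_add] at h1
  refine le_of_tendsto_of_tendsto hL h1 ?_
  filter_upwards [eventually_gt_atTop 0] with n hn
  have hn' : (0 : ℝ) < n := by exact_mod_cast hn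
  have h2 : Real.logb 2 (m n) ≤ Real.logb 2 C + n * x := by
    have := Real.logb_le_logb_of_le one_lt_two (hpos n) (h n)
    rwa [Real.logb_mul hC.ne' (by positivity), Real.logb_rpow two_pos (by norm_num)] at this
  rw [div_mul_eq_mul_div, one_mul, div_le_iff₀ hn', add_mul, div_mul_cancel₀ _ hn'.ne']
  linarith

/-- Existence of the limit defining a dilation index, and the bounds for it. -/
lemma exists_index {φ : ℝ → ℝ} (hφ : TameGrowth φ) (r : ℝ) {T : ℕ → Set ℝ}
    (hT : ∀ n, T n ⊆ Set.Ioi 0) (hne : ∀ n, (T n).Nonempty)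
    (hadd : ∀ i j s, s ∈ T (i + j) → s ∈ T j ∧ r ^ j * s ∈ T i)
    (hup : ∀ n s, 0 < s → φ (r ^ n * s) ≤ 2 ^ n * φ s)
    (hlow : ∀ n s, 0 < s → (1 / 2) ^ n * φ s ≤ φ (r ^ n * s)) :
    ∃ L, Tendsto (fun n : ℕ => 1 / (n : ℝ) *
        Real.logb 2 (⨆ s : T n, φ (r ^ n * s) / φ s)) atTop (𝓝 L) ∧
      (∀ C x : ℝ, 0 < C → (∀ n : ℕ, ∀ s ∈ T n, φ (r ^ n * s) ≤ C * 2 ^ (n * x) * φ s) → L ≤ x) ∧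
      ((∀ n : ℕ, ∀ s ∈ T n, φ s ≤ φ (r ^ n * s)) → 0 ≤ L) := by
  have hbdd : ∀ n, BddAbove (Set.range fun s : T n => φ (r ^ n * s) / φ s) := fun n => by
    refine ⟨2 ^ n, ?_⟩
    rintro _ ⟨s, rfl⟩
    exact (div_le_iff₀ (hφ.pos s (hT n s.2))).2 (hup n s (hT n s.2))
  have hle : ∀ n, ∀ s ∈ T n, φ (r ^ n * s) / φ s ≤ ⨆ s : T n, φ (r ^ n * s) / φ s :=
    fun n s hs => le_ciSup (hbdd n) ⟨s, hs⟩
  have hq : ∀ n s, 0 < s → (1 / 2 : ℝ) ^ n ≤ φ (r ^ n * s) / φ s := fun n s hs =>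
    (le_div_iff₀ (hφ.pos s hs)).2 (hlow n s hs)
  have hlow' : ∀ n, (1 / 2 : ℝ) ^ n ≤ ⨆ s : T n, φ (r ^ n * s) / φ s := fun n => by
    obtain ⟨s, hs⟩ := hne n
    exact (hq n s (hT n hs)).trans (hle n s hs)
  have hpos : ∀ n, 0 < ⨆ s : T n, φ (r ^ n * s) / φ s := fun n =>
    lt_of_lt_of_le (by positivity) (hlow' n)
  have hne' : ∀ n, Nonempty (T n) := fun n => (hne n).to_subtype
  -- Submultiplicativity comes from passing through the intermediate point `r ^ j * s`, which `hadd`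
  -- keeps in the admissible range.
  obtain ⟨L, hL⟩ := tendsto_logb_of_submultiplicative hpos (fun i j => by
    have := hne' (i + j)
    refine ciSup_le fun ⟨s, hs⟩ => ?_
    obtain ⟨h1, h2⟩ := hadd i j s hs
    have hs0 : 0 < s := hT _ hs
    have hp := hφ.pos _ (hT _ h2)
    have hp' := hφ.pos _ hs0
    calc φ (r ^ (i + j) * s) / φ s
        = φ (r ^ i * (r ^ j * s)) / φ (r ^ j * s) * (φ (r ^ j * s) / φ s) := by
          rw [div_mul_div_cancel₀ hp.ne', pow_add, mul_assoc]
      _ ≤ _ := mul_le_mul (hle i _ h2) (hle j _ h1) (div_pos hp hp').le (hpos i).le) hlow'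
  refine ⟨L, hL, fun C x hC h => index_le_of_le hpos hL hC fun n => ?_, fun h => ?_⟩
  · have := hne' n
    exact ciSup_le fun ⟨s, hs⟩ => (div_le_iff₀ (hφ.pos _ (hT n hs))).2 (h n s hs)
  · refine ge_of_tendsto' hL fun n => mul_nonneg (by positivity) (Real.logb_nonneg one_lt_two ?_)
    obtain ⟨s, hs⟩ := hne n
    exact ((one_le_div (hφ.pos s (hT n hs))).2 (h n s hs)).trans (hle n s hs)

namespace TameGrowth

variable {φ : ℝ → ℝ} (hφ : TameGrowth φ)

include hφ

lemma le_two_pow (n : ℕ) {s : ℝ} (hs : 0 < s) : φ s ≤ φ (2 ^ n * s) :=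
  hφ.mono _ _ hs (le_mul_of_one_le_left hs.le (one_le_pow₀ one_le_two))

lemma half_pow_le (n : ℕ) {s : ℝ} (hs : 0 < s) : φ ((1 / 2) ^ n * s) ≤ φ s :=
  hφ.mono _ _ (by positivity)
    (mul_le_of_le_one_left hs.le (pow_le_one₀ (by norm_num) (by norm_num)))

lemma le_half_pow (n : ℕ) {s : ℝ} (hs : 0 < s) : (1 / 2) ^ n * φ s ≤ φ ((1 / 2) ^ n * s) := by
  have h := hφ.two_pow n ((1 / 2) ^ n * s) (by positivity)
  rw [← mul_assoc, ← mul_pow, mul_one_div_cancel two_ne_zero, one_pow, one_mul] at h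
  have h2 := mul_le_mul_of_nonneg_left h (show (0 : ℝ) ≤ (1 / 2) ^ n by positivity)
  rwa [← mul_assoc ((1 / 2 : ℝ) ^ n) (2 ^ n), ← mul_pow, one_div_mul_cancel two_ne_zero, one_pow,
    one_mul] at h2

lemma exists_upperIndex {T : ℕ → Set ℝ}
    (hT : ∀ n, T n ⊆ Set.Ioi 0) (hne : ∀ n, (T n).Nonempty)
    (hadd : ∀ i j s, s ∈ T (i + j) → s ∈ T j ∧ 2 ^ j * s ∈ T i) {M : ℝ → ℝ}
    (hM : ∀ n : ℕ, M (2 ^ n) = ⨆ s : T n, φ (2 ^ n * s) / φ s) :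
    0 ≤ upperIndex M ∧ ∀ C x : ℝ, 0 < C →
      (∀ n : ℕ, ∀ s ∈ T n, φ (2 ^ n * s) ≤ C * (2 ^ n) ^ x * φ s) → upperIndex M ≤ x := by
  obtain ⟨L, hL, h1, h2⟩ := exists_index hφ 2 hT hne hadd (fun n s hs => hφ.two_pow n s hs)
    fun n s hs => (mul_le_of_le_one_left (hφ.pos s hs).le
      (pow_le_one₀ (by norm_num) (by norm_num))).trans (hφ.le_two_pow n hs)
  simp only [← hM] at hL
  rw [upperIndex, hL.limUnder_eq]
  refine ⟨h2 fun n s hs => hφ.le_two_pow n (hT n hs), fun C x hC h => h1 C x hC fun n s hs => ?_⟩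
  rw [Real.rpow_mul two_pos.le, Real.rpow_natCast]
  exact h n s hs

lemma exists_lowerIndex {T : ℕ → Set ℝ}
    (hT : ∀ n, T n ⊆ Set.Ioi 0) (hne : ∀ n, (T n).Nonempty)
    (hadd : ∀ i j s, s ∈ T (i + j) → s ∈ T j ∧ (1 / 2) ^ j * s ∈ T i) {M : ℝ → ℝ}
    (hM : ∀ n : ℕ, M ((1 / 2) ^ n) = ⨆ s : T n, φ ((1 / 2) ^ n * s) / φ s) :
    ∀ C x : ℝ, 0 < C →
      (∀ n : ℕ, ∀ s ∈ T n, φ ((1 / 2) ^ n * s) ≤ C * ((1 / 2) ^ n) ^ x * φ s) →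
        x ≤ lowerIndex M := by
  obtain ⟨L, hL, h1, -⟩ := exists_index hφ (1 / 2) hT hne hadd
    (fun n s hs => (hφ.half_pow_le n hs).trans
      (le_mul_of_one_le_left (hφ.pos s hs).le (one_le_pow₀ one_le_two)))
    fun n s hs => hφ.le_half_pow n hs
  simp only [← hM] at hL
  have hz : ∀ n : ℕ, (2 : ℝ) ^ (-(n : ℤ)) = (1 / 2) ^ n := fun n => by
    rw [zpow_neg, zpow_natCast, one_div, inv_pow]
  intro C x hC h
  simp only [lowerIndex, hz]
  rw [hL.limUnder_eq, le_neg]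
  refine h1 C (-x) hC fun n s hs => ?_
  have e : (2 : ℝ) ^ ((n : ℝ) * -x) = ((1 / 2) ^ n) ^ x := by
    rw [mul_neg, Real.rpow_neg two_pos.le, Real.rpow_mul two_pos.le, Real.rpow_natCast, one_div,
      inv_pow, Real.inv_rpow (by positivity)]
  rw [e]
  exact h n s hs

lemma nuIndex_spec : 0 ≤ nuIndex φ ∧ ∀ C x : ℝ, 0 < C →
    (∀ (n : ℕ) s, 0 < s → φ (2 ^ n * s) ≤ C * (2 ^ n) ^ x * φ s) → nuIndex φ ≤ x :=
  hφ.exists_upperIndex (T := fun _ => Set.Ioi 0) (M := dil φ) (fun _ => subset_rfl)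
    (fun _ => ⟨1, Set.mem_Ioi.2 one_pos⟩)
    (fun _ j _ hs => ⟨hs, Set.mem_Ioi.2 (mul_pos (pow_pos two_pos j) hs)⟩) fun _ => rfl

lemma le_muIndex : ∀ C x : ℝ, 0 < C →
    (∀ (n : ℕ) s, 0 < s → φ ((1 / 2) ^ n * s) ≤ C * ((1 / 2) ^ n) ^ x * φ s) → x ≤ muIndex φ :=
  hφ.exists_lowerIndex (T := fun _ => Set.Ioi 0) (M := dil φ) (fun _ => subset_rfl)
    (fun _ => ⟨1, Set.mem_Ioi.2 one_pos⟩)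
    (fun _ j _ hs => ⟨hs, Set.mem_Ioi.2 (mul_pos (pow_pos one_half_pos j) hs)⟩) fun _ => rfl

lemma nuZeroIndex_spec : 0 ≤ nuZeroIndex φ ∧ ∀ C x : ℝ, 0 < C →
    (∀ (n : ℕ) s, 0 < s → 2 ^ n * s ≤ 1 → φ (2 ^ n * s) ≤ C * (2 ^ n) ^ x * φ s) →
      nuZeroIndex φ ≤ x := by
  have hmem : ∀ (n : ℕ) (s : ℝ), s ∈ Set.Ioc (0 : ℝ) (min 1 (1 / 2 ^ n)) ↔
      0 < s ∧ 2 ^ n * s ≤ 1 := fun n s => by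
    have h2 : (0 : ℝ) < 2 ^ n := by positivity
    have h1 : (1 : ℝ) ≤ 2 ^ n := one_le_pow₀ one_le_two
    rw [min_eq_right ((div_le_one h2).2 h1), Set.mem_Ioc, le_div_iff₀ h2, mul_comm]
  obtain ⟨h1, h2⟩ := hφ.exists_upperIndex (T := fun n => Set.Ioc (0 : ℝ) (min 1 (1 / 2 ^ n)))
    (M := dilZero φ) (fun n s hs => hs.1) (fun n => ⟨min 1 (1 / 2 ^ n), by positivity, le_rfl⟩)
    (fun i j s hs => by
      rw [hmem] at hs ⊢
      rw [hmem]
      obtain ⟨h0, h1⟩ := hs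
      rw [pow_add, mul_assoc] at h1
      have hj : (0 : ℝ) < 2 ^ j * s := by positivity
      refine ⟨⟨h0, ?_⟩, hj, h1⟩
      exact (le_mul_of_one_le_left hj.le (one_le_pow₀ one_le_two)).trans h1) fun _ => rfl
  refine ⟨h1, fun C x hC h => h2 C x hC fun n s hs => ?_⟩
  rw [hmem] at hs
  exact h n s hs.1 hs.2

lemma le_muInftyIndex : ∀ C x : ℝ, 0 < C →
    (∀ (n : ℕ) s, 0 < s → 1 ≤ (1 / 2) ^ n * s →
      φ ((1 / 2) ^ n * s) ≤ C * ((1 / 2) ^ n) ^ x * φ s) → x ≤ muInftyIndex φ := by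
  have hmem : ∀ (n : ℕ) (s : ℝ), s ∈ Set.Ici (max (1 : ℝ) (1 / (1 / 2) ^ n)) ↔
      0 < s ∧ 1 ≤ (1 / 2) ^ n * s := fun n s => by
    have h2 : (0 : ℝ) < (1 / 2) ^ n := by positivity
    have h1 : ((1 : ℝ) / 2) ^ n ≤ 1 := pow_le_one₀ (by norm_num) (by norm_num)
    rw [max_eq_right ((one_le_div h2).2 h1), Set.mem_Ici, div_le_iff₀ h2, mul_comm]
    exact ⟨fun h => ⟨by by_contra! hc; nlinarith, h⟩, fun h => h.2⟩
  have h2 := hφ.exists_lowerIndex (T := fun n => Set.Ici (max (1 : ℝ) (1 / (1 / 2) ^ n)))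
    (M := dilInfty φ) (fun n s hs => ((hmem n s).1 hs).1) (fun n => ⟨_, Set.self_mem_Ici⟩)
    (fun i j s hs => by
      rw [hmem] at hs ⊢
      rw [hmem]
      obtain ⟨h0, h1⟩ := hs
      rw [pow_add, mul_assoc] at h1
      have hj : (0 : ℝ) < (1 / 2) ^ j * s := by positivity
      refine ⟨⟨h0, ?_⟩, hj, h1⟩
      exact h1.trans (mul_le_of_le_one_left hj.le (pow_le_one₀ (by norm_num) (by norm_num))))
    fun _ => rfl
  refine fun C x hC h => h2 C x hC fun n s hs => ?_
  rw [hmem] at hs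
  exact h n s hs.1 hs.2

end TameGrowth

/-! ### The dichotomy when two-sided decay fails, and its consequences for the indices. -/

/-- At the points satisfying this, `t ^ (-θ) * φ t` decays like a power towards `0`
from the left. -/
def DecaysFromLeft (φ : ℝ → ℝ) (θ e C c : ℝ) : Prop :=
  ∀ a, 0 < a → a ≤ c → φ c ≤ C * (c / a) ^ (θ - e) * φ a

/-- At the points satisfying this, `t ^ (-θ) * φ t` grows like a power to the right. -/
def GrowsToRight (φ : ℝ → ℝ) (θ e C c : ℝ) : Prop :=
  ∀ b, c ≤ b → φ c ≤ C * (c / b) ^ (θ + e) * φ b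

lemma exists_of_not_decaysBothSides {φ : ℝ → ℝ} {θ : ℝ} (h : ¬ DecaysBothSides φ θ) :
    ∃ e C : ℝ, 0 < e ∧ 0 < C ∧ ∀ c, 0 < c → DecaysFromLeft φ θ e C c ∨ GrowsToRight φ θ e C c := by
  unfold DecaysBothSides at h
  push Not at h
  obtain ⟨e, he, δ, hδ, h⟩ := h
  refine ⟨e, δ⁻¹, he, inv_pos.2 hδ, fun c hc => ?_⟩
  by_contra! hcon
  obtain ⟨h1, h2⟩ := hcon
  unfold DecaysFromLeft at h1
  unfold GrowsToRight at h2
  push Not at h1 h2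
  obtain ⟨a, ha, hac, h1⟩ := h1
  obtain ⟨b, hcb, h2⟩ := h2
  have hb : 0 < b := hc.trans_le hcb
  refine absurd (h a c b ha hac hcb ?_) (not_lt.2 ?_)
  · have e1 : (c / a) ^ (θ - e) = (a / c) ^ e * a ^ (-θ) * c ^ θ := by
      rw [sub_eq_add_neg, Real.rpow_add (by positivity), Real.rpow_neg (by positivity) e,
        ← Real.inv_rpow (by positivity), inv_div, Real.div_rpow hc.le ha.le, Real.rpow_neg ha.le]
      field_simp
    rw [e1] at h1
    have h3 := mul_lt_mul_of_pos_left h1 (show 0 < δ * c ^ (-θ) by positivity)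
    have e2 : δ * c ^ (-θ) * (δ⁻¹ * ((a / c) ^ e * a ^ (-θ) * c ^ θ) * φ a) =
        φ a * ((a / c) ^ e * a ^ (-θ)) := by
      rw [Real.rpow_neg hc.le]; field_simp
    rw [e2] at h3
    linarith
  · have e1 : (c / b) ^ (θ + e) = (c / b) ^ e * b ^ (-θ) * c ^ θ := by
      rw [Real.rpow_add (by positivity), Real.div_rpow hc.le hb.le θ, Real.rpow_neg hb.le]
      field_simp
    rw [e1] at h2
    have h3 := mul_lt_mul_of_pos_left h2 (show 0 < δ * c ^ (-θ) by positivity)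
    have e2 : δ * c ^ (-θ) * (δ⁻¹ * ((c / b) ^ e * b ^ (-θ) * c ^ θ) * φ b) =
        φ b * ((c / b) ^ e * b ^ (-θ)) := by
      rw [Real.rpow_neg hc.le]; field_simp
    rw [e2] at h3
    linarith

namespace TameGrowth

variable {φ : ℝ → ℝ} (hφ : TameGrowth φ) {θ e C : ℝ} (he : 0 < e) (hC : 0 < C)

include hφ he hC

/-- If `r < l`, combining the two conditions on the pair gives `φ l ≤ C² * (l/r)^(-2e) * φ l`, which
bounds `l / r`. -/
lemma exists_ratio_bound : ∃ Q, 0 < Q ∧ ∀ l r, 0 < l → 0 < r → DecaysFromLeft φ θ e C l →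
    GrowsToRight φ θ e C r → l ≤ Q * r := by
  refine ⟨max 1 ((C * C) ^ (2 * e)⁻¹), by positivity, fun l r hl hr hL hR => ?_⟩
  rcases le_or_gt l r with h | h
  · exact h.trans (le_mul_of_one_le_left hr.le (le_max_left _ _))
  have h1 := hL r hr h.le
  have h2 := hR l h.le
  have hx : 0 < l / r := div_pos hl hr
  have e1 : (r / l) ^ (θ + e) = (l / r) ^ (-(θ + e)) := by
    rw [Real.rpow_neg hx.le, ← Real.inv_rpow hx.le, inv_div]
  rw [e1] at h2
  have hpl := hφ.pos l hl
  have h3 : φ l ≤ C * C * (l / r) ^ (-(2 * e)) * φ l := by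
    calc φ l ≤ C * (l / r) ^ (θ - e) * φ r := h1
      _ ≤ C * (l / r) ^ (θ - e) * (C * (l / r) ^ (-(θ + e)) * φ l) := by gcongr
      _ = C * C * ((l / r) ^ (θ - e) * (l / r) ^ (-(θ + e))) * φ l := by ring
      _ = _ := by
        rw [← Real.rpow_add hx]; congr 3; ring
  have h4 : 1 ≤ C * C * (l / r) ^ (-(2 * e)) := by
    by_contra! hc
    nlinarith
  rw [Real.rpow_neg hx.le, ← div_eq_mul_inv, one_le_div (by positivity)] at h4
  have h5 : l / r ≤ (C * C) ^ (2 * e)⁻¹ := by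
    rwa [Real.le_rpow_inv_iff_of_pos hx.le (by positivity) (by positivity)]
  rw [← div_le_iff₀ hr]
  exact h5.trans (le_max_right _ _)

variable (h : ∀ c, 0 < c → DecaysFromLeft φ θ e C c ∨ GrowsToRight φ θ e C c)

include h

/-- By the ratio bound, no point below `l / Q` grows to the right, so all of them decay from the
left. Shrinking `(0, 1]` by `2 ^ m` moves it below `l / Q`, at the cost of the constant `2 ^ m`. -/
lemma nuZeroIndex_le {l : ℝ} (hl : 0 < l) (hL : DecaysFromLeft φ θ e C l) :
    nuZeroIndex φ ≤ θ - e := by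
  obtain ⟨Q, hQ, hlr⟩ := hφ.exists_ratio_bound (θ := θ) he hC
  obtain ⟨m, hm⟩ := pow_unbounded_of_one_lt (Q / l) one_lt_two
  refine hφ.nuZeroIndex_spec.2 (2 ^ m * C) _ (by positivity) fun n s hs hns => ?_
  set u := s / 2 ^ m with hu
  have h2 : (0 : ℝ) < 2 ^ m := by positivity
  have hu0 : 0 < u := by positivity
  have hsu : s = 2 ^ m * u := by rw [hu]; field_simp
  have hc0 : 0 < 2 ^ n * u := by positivity
  have hc : DecaysFromLeft φ θ e C (2 ^ n * u) := by
    refine (h _ hc0).resolve_right fun hR => ?_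
    have h3 := hlr l _ hl hc0 hL hR
    rw [div_lt_iff₀ hl] at hm
    rw [hsu] at hns
    have h4 : 2 ^ m * (2 ^ n * u) ≤ 1 := by linarith
    nlinarith [mul_le_mul_of_nonneg_left h3 h2.le, mul_le_mul_of_nonneg_left h4 hQ.le]
  have h5 := hc u hu0 (le_mul_of_one_le_left hu0.le (one_le_pow₀ one_le_two))
  rw [mul_div_cancel_right₀ _ hu0.ne'] at h5
  calc φ (2 ^ n * s) = φ (2 ^ m * (2 ^ n * u)) := by rw [hsu]; congr 1; ring
    _ ≤ 2 ^ m * φ (2 ^ n * u) := hφ.two_pow m _ hc0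
    _ ≤ 2 ^ m * (C * (2 ^ n) ^ (θ - e) * φ u) := by gcongr
    _ ≤ 2 ^ m * (C * (2 ^ n) ^ (θ - e) * φ s) := by
      have h6 : φ u ≤ φ s := by rw [hsu]; exact hφ.le_two_pow m hu0
      gcongr
    _ = _ := by ring

/-- Symmetrically, all points above `Q * r` grow to the right, and scaling `[1, ∞)` by `2 ^ m > Q *
r` moves it there. -/
lemma le_muInftyIndex_of_growsToRight {r : ℝ} (hr : 0 < r) (hR : GrowsToRight φ θ e C r) :
    θ + e ≤ muInftyIndex φ := by
  obtain ⟨Q, hQ, hlr⟩ := hφ.exists_ratio_bound (θ := θ) he hC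
  obtain ⟨m, hm⟩ := pow_unbounded_of_one_lt (Q * r) one_lt_two
  refine hφ.le_muInftyIndex (2 ^ m * C) _ (by positivity) fun n s hs hns => ?_
  set t : ℝ := (1 / 2) ^ n
  have ht : 0 < t := by positivity
  have ht1 : t ≤ 1 := pow_le_one₀ (by norm_num) (by norm_num)
  have h2 : (0 : ℝ) < 2 ^ m := by positivity
  have hc0 : 0 < t * (2 ^ m * s) := by positivity
  have hc : GrowsToRight φ θ e C (t * (2 ^ m * s)) := by
    refine (h _ hc0).resolve_left fun hL => ?_
    have h3 := hlr _ r hc0 hr hL hR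
    nlinarith
  have h5 := hc (2 ^ m * s) (mul_le_of_le_one_left (by positivity) ht1)
  rw [mul_div_cancel_right₀ _ (by positivity)] at h5
  calc φ (t * s) ≤ φ (2 ^ m * (t * s)) := hφ.le_two_pow m (by positivity)
    _ = φ (t * (2 ^ m * s)) := by congr 1; ring
    _ ≤ C * t ^ (θ + e) * φ (2 ^ m * s) := h5
    _ ≤ C * t ^ (θ + e) * (2 ^ m * φ s) := by
      have := hφ.two_pow m s hs
      gcongr
    _ = _ := by ring

omit he h in
lemma nuIndex_le_of_forall (hL : ∀ c, 0 < c → DecaysFromLeft φ θ e C c) :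
    nuIndex φ ≤ θ - e := by
  refine hφ.nuIndex_spec.2 C _ hC fun n s hs => ?_
  have := hL (2 ^ n * s) (by positivity) s hs
    (le_mul_of_one_le_left hs.le (one_le_pow₀ one_le_two))
  rwa [mul_div_cancel_right₀ _ hs.ne'] at this

omit he h in
lemma le_muIndex_of_forall (hR : ∀ c, 0 < c → GrowsToRight φ θ e C c) :
    θ + e ≤ muIndex φ := by
  refine hφ.le_muIndex C _ hC fun n s hs => ?_
  have := hR ((1 / 2) ^ n * s) (by positivity) s
    (mul_le_of_le_one_left hs.le (pow_le_one₀ (by norm_num) (by norm_num)))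
  rwa [mul_div_cancel_right₀ _ hs.ne'] at this

end TameGrowth

/-- If two-sided decay failed, `θ ≤ ν` would force a point growing to the right, hence `μ^∞ ≥ θ +
e`; and `μ ≤ θ` would force a point decaying from the left, hence `ν⁰ ≤ θ - e`. In the first case
both hold and give `ν⁰ < μ^∞`; in each of the other two, one is already contradictory. -/
lemma TameGrowth.decaysBothSides {φ : ℝ → ℝ} (hφ : TameGrowth φ) {θ : ℝ}
    (hθ : (muIndex φ ≤ θ ∧ θ ≤ nuIndex φ ∧ muInftyIndex φ ≤ nuZeroIndex φ) ∨
      (muInftyIndex φ ≤ θ ∧ θ ≤ nuIndex φ) ∨ (muIndex φ ≤ θ ∧ θ ≤ nuZeroIndex φ)) :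
    DecaysBothSides φ θ := by
  by_contra hcon
  obtain ⟨e, C, he, hC, h⟩ := exists_of_not_decaysBothSides hcon
  have hν : θ ≤ nuIndex φ → θ + e ≤ muInftyIndex φ := fun hn => by
    by_contra hc
    have := hφ.nuIndex_le_of_forall hC fun c h0 => (h c h0).resolve_right fun hR =>
      hc (hφ.le_muInftyIndex_of_growsToRight he hC h h0 hR)
    linarith
  have hμ : muIndex φ ≤ θ → nuZeroIndex φ ≤ θ - e := fun hn => by
    by_contra hc
    have := hφ.le_muIndex_of_forall hC fun c h0 => (h c h0).resolve_left fun hL =>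
      hc (hφ.nuZeroIndex_le he hC h h0 hL)
    linarith
  rcases hθ with ⟨h1, h2, h3⟩ | ⟨h1, h2⟩ | ⟨h1, h2⟩
  · linarith [hμ h1, hν h2]
  · linarith [hν h2]
  · linarith [hμ h1]

lemma TameGrowth.nuIndex_le_one {φ : ℝ → ℝ} (hφ : TameGrowth φ) : nuIndex φ ≤ 1 :=
  hφ.nuIndex_spec.2 1 1 one_pos fun n s hs => by simpa using hφ.two_pow n s hs

lemma TameGrowth.nuZeroIndex_le_one {φ : ℝ → ℝ} (hφ : TameGrowth φ) : nuZeroIndex φ ≤ 1 :=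
  hφ.nuZeroIndex_spec.2 1 1 one_pos fun n s hs _ => by simpa using hφ.two_pow n s hs

lemma IsRISpace.tameGrowth {E : Type*} [NormedAddCommGroup E] [NormedSpace ℝ E] {ι : E →ₗ[ℝ] S}
    (hι : IsRISpace ι) : TameGrowth (fundamentalFunction ι) := by
  rw [show fundamentalFunction ι = fun t => nrm ι (chi t) from
    funext hι.fundamentalFunction_eq]
  exact ⟨fun s hs => hι.nrm_chi_pos hs, fun s t _ hst => hι.nrm_chi_mono hst,
    fun n s hs => hι.nrm_chi_two_pow_mul hs n⟩

/-! ### From exponents `p` to `θ = 1/p`, and the theorem. -/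

lemma le_toReal_inv_of_le_recip {p : ENNReal} (hp : p ≠ 0) {x : ℝ} (h : p ≤ recip x) :
    x ≤ (p⁻¹).toReal := by
  rw [recip, ENNReal.le_inv_iff_le_inv] at h
  exact (ENNReal.ofReal_le_iff_le_toReal (ENNReal.inv_ne_top.2 hp)).1 h

lemma toReal_inv_le_of_recip_le {p : ENNReal} {x : ℝ} (hx : 0 ≤ x) (h : recip x ≤ p) :
    (p⁻¹).toReal ≤ x := by
  rw [recip, ENNReal.inv_le_iff_inv_le] at h
  exact ENNReal.toReal_le_of_le_ofReal hx h

lemma one_le_recip {x : ℝ} (hx : x ≤ 1) : 1 ≤ recip x := by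
  rw [recip, ENNReal.one_le_inv]
  exact ENNReal.ofReal_le_one.2 hx

end RISpaces

end

theorem mainTheorem7 {E : Type*} [NormedAddCommGroup E] [NormedSpace ℝ E]
    (ι : E →ₗ[ℝ] RISpaces.S) (hι : RISpaces.IsRISpace ι)
    (hsep : TopologicalSpace.SeparableSpace E)
    (φ : ℝ → ℝ) (hφ : φ = RISpaces.fundamentalFunction ι)
    (e : ℕ ≃ ℕ × ℕ) :
    (RISpaces.muInftyIndex φ ≤ RISpaces.nuZeroIndex φ →
      ∀ p : ENNReal,
        p ∈ Set.Icc (RISpaces.recip (RISpaces.nuIndex φ)) (RISpaces.recip (RISpaces.muIndex φ)) →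
        RISpaces.SymmetricallyBlockFinitelyRepresented ι p
          (fun i => RISpaces.dyadicChar (e i).1 (e i).2)) ∧
    (RISpaces.nuZeroIndex φ < RISpaces.muInftyIndex φ →
      ∀ p : ENNReal,
        p ∈ Set.Icc (RISpaces.recip (RISpaces.nuIndex φ))
              (RISpaces.recip (RISpaces.muInftyIndex φ)) ∪
            Set.Icc (RISpaces.recip (RISpaces.nuZeroIndex φ))
              (RISpaces.recip (RISpaces.muIndex φ)) →
        RISpaces.SymmetricallyBlockFinitelyRepresented ι p
          (fun i => RISpaces.dyadicChar (e i).1 (e i).2)) := by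
  subst hφ
  have hφ := hι.tameGrowth
  -- The interval for `p` becomes `y ≤ θ ≤ x`; the bound `x ≤ 1` on the upper index ensures `p ≥ 1`.
  -- Only `x` needs a sign condition.
  have key : ∀ x y : ℝ, 0 ≤ x → x ≤ 1 → ∀ p : ENNReal,
      p ∈ Set.Icc (RISpaces.recip x) (RISpaces.recip y) →
      Fact (1 ≤ p) ∧ (p⁻¹).toReal ≤ x ∧ y ≤ (p⁻¹).toReal := fun x y h0 h1 p hp => by
    have hp1 : 1 ≤ p := (RISpaces.one_le_recip h1).trans hp.1
    exact ⟨⟨hp1⟩, RISpaces.toReal_inv_le_of_recip_le h0 hp.1,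
      RISpaces.le_toReal_inv_of_le_recip (zero_lt_one.trans_le hp1).ne' hp.2⟩
  refine ⟨fun h p hp => ?_, fun _ p hp => ?_⟩
  · obtain ⟨hp1, h1, h2⟩ := key _ _ hφ.nuIndex_spec.1 hφ.nuIndex_le_one p hp
    exact hι.symmetricallyBlockFinitelyRepresented (hφ.decaysBothSides (Or.inl ⟨h2, h1, h⟩)) e
  · rcases hp with hp | hp
    · obtain ⟨hp1, h1, h2⟩ := key _ _ hφ.nuIndex_spec.1 hφ.nuIndex_le_one p hp
      exact hι.symmetricallyBlockFinitelyRepresented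
        (hφ.decaysBothSides (Or.inr (Or.inl ⟨h2, h1⟩))) e
    · obtain ⟨hp1, h1, h2⟩ := key _ _ hφ.nuZeroIndex_spec.1 hφ.nuZeroIndex_le_one p hp
      exact hι.symmetricallyBlockFinitelyRepresented
        (hφ.decaysBothSides (Or.inr (Or.inr ⟨h2, h1⟩))) e
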